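/- Let $t\in\mathbb C\setminus\{0,1\}$, let $\theta_0,\theta_1,\theta_t,\theta_\infty,\lambda,\mu,k\in\mathbb C$, and put $\kappa_1=(\theta_\infty-\theta_0-\theta_1-\theta_t)/2$, $\kappa_2=-(\theta_\infty+\theta_0+\theta_1+\theta_t)/2$. When $k,\theta_\infty\neq0$ and $\lambda\notin\{0,1,t\}$, denote by $D_Y(\theta_0,\theta_1,\theta_t,\theta_\infty;\lambda,\mu;k)$ the Fuchsian system $$\frac{dY}{dz}=\Bigl(\frac{A_0}{z}+\frac{A_1}{z-1}+\frac{A_t}{z-t}\Bigr)Y,\qquad Y={}^t(y_1,y_2),\qquad A_i=\begin{pmatrix}u_i+\theta_i&-w_i\\ u_i(u_i+\theta_i)/w_i&-u_i\end{pmatrix}\quad(i=0,1,t),$$ where $w_0=\frac{k\lambda}{t}$, $w_1=-\frac{k(\lambda-1)}{t-1}$, $w_t=\frac{k(\lambda-t)}{t(t-1)}$ and $$u_0=-\theta_0+\tfrac{\lambda}{t\theta_\infty}\bigl[\lambda(\lambda-1)(\lambda-t)\mu^2+\{2\kappa_1(\lambda-1)(\lambda-t)-\theta_1(\lambda-t)-t\theta_t(\lambda-1)\}\mu+\kappa_1\{\kappa_1(\lambda-t-1)-\theta_1-t\theta_t\}\bigr],$$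 $$u_1=-\theta_1-\tfrac{\lambda-1}{(t-1)\theta_\infty}\bigl[\lambda(\lambda-1)(\lambda-t)\mu^2+\{2\kappa_1(\lambda-1)(\lambda-t)+(\theta_\infty-\theta_1)(\lambda-t)-t\theta_t(\lambda-1)\}\mu+\kappa_1\{\kappa_1(\lambda-t+1)+\theta_0-(t-1)\theta_t\}\bigr],$$ $$u_t=-\theta_t+\tfrac{\lambda-t}{t(t-1)\theta_\infty}\bigl[\lambda(\lambda-1)(\lambda-t)\mu^2+\{2\kappa_1(\lambda-1)(\lambda-t)-\theta_1(\lambda-t)+t(\theta_\infty-\theta_t)(\lambda-1)\}\mu+\kappa_1\{\kappa_1(\lambda-t+1)+\theta_0+(t-1)(\theta_\infty-\theta_t)\}\bigr].$$ Fix a base point $o\in\mathbb C\setminus\{0,1,t\}$. For $z\in\mathbb C\setminus\{0,1,t,o\}$ and $i\in\{0,1,t,\infty\}$ let $\alpha_z$ and $\alpha_i$ be loops in $\mathbb C\setminus\{0,1,t,z\}$ based at $o$ that turn once anticlockwise around $w=z$ and $w=i$ respectively: a $C^1$ path from $o$ to a point $p$, then once around a circle through $p$ that separates the point in question from all the other points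 of $\{0,1,t,z,\infty\}$, then back along the same path. (The circle is centred at the point in question; for $i=\infty$ it is centred at $0$ and, anticlockwise being understood as seen from $\infty$, traversed clockwise in the plane.) Let $[\alpha_z,\alpha_i]=\alpha_z^{-1}\alpha_i^{-1}\alpha_z\alpha_i$ be the Pochhammer contour. **Proposition.** Assume that $k,\mu,\theta_\infty,\kappa_2\neq0$ and that neither $\lambda$ nor $\tilde\lambda:=\lambda+\kappa_1/\mu$ lies in $\{0,1,t\}$. Let $Y={}^t(y_1,y_2)$ be a (multivalued) solution of $D_Y(\theta_0,\theta_1,\theta_t,\theta_\infty;\lambda,\mu;k)$, given near $o$ and continued analytically along the contours. Let $i\in\{0,1,t,\infty\}$, and set $$\tilde y_1(z)=\int_{[\alpha_z,\alpha_i]}\Bigl\{\kappa_1y_1(w)+(w-\tilde\lambda)\frac{dy_1(w)}{dw}\Bigr\}\frac{(z-w)^{\kappa_1}}{w-\lambda}\,dw,\qquad \tilde y_2(z)=-\frac{\theta_\infty}{\kappa_2}\int_{[\alpha_z,\alpha_i]}\frac{dy_2(w)}{dw}\,(z-w)^{\kappa_1}\,dw,$$ where the contour $[\alpha_z,\alpha_i]$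 and the branch of $\log(z-w)$ along it, which defines $(z-w)^{\kappa_1}$, depend continuously on $z$ in an open set $U\subset\mathbb C\setminus\{0,1,t\}$. Then the integrals converge absolutely and $\tilde Y={}^t(\tilde y_1,\tilde y_2)$ satisfies on $U$ the system $$D_Y(\kappa_1+\theta_0,\ \kappa_1+\theta_1,\ \kappa_1+\theta_t,\ -\kappa_2;\ \lambda+\kappa_1/\mu,\ \mu;\ k).$$ -/

import Mathlib

open Set Filter Topology Matrix unitInterval

namespace FuchsianMC

noncomputable section

/-- `κ₁ = (θ_∞ - θ₀ - θ₁ - θ_t) / 2`. -/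
def kappa1 (θ₀ θ₁ θt θi : ℂ) : ℂ := (θi - θ₀ - θ₁ - θt) / 2

/-- `κ₂ = -(θ_∞ + θ₀ + θ₁ + θ_t) / 2`. -/
def kappa2 (θ₀ θ₁ θt θi : ℂ) : ℂ := -(θi + θ₀ + θ₁ + θt) / 2

def u0 (t θ₀ θ₁ θt θi lam mu : ℂ) : ℂ :=
  -θ₀ + lam / (t * θi) *
    (lam * (lam - 1) * (lam - t) * mu ^ 2
      + (2 * kappa1 θ₀ θ₁ θt θi * (lam - 1) * (lam - t) - θ₁ * (lam - t)
          - t * θt * (lam - 1)) * mu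
      + kappa1 θ₀ θ₁ θt θi * (kappa1 θ₀ θ₁ θt θi * (lam - t - 1) - θ₁ - t * θt))

def u1 (t θ₀ θ₁ θt θi lam mu : ℂ) : ℂ :=
  -θ₁ - (lam - 1) / ((t - 1) * θi) *
    (lam * (lam - 1) * (lam - t) * mu ^ 2
      + (2 * kappa1 θ₀ θ₁ θt θi * (lam - 1) * (lam - t) + (θi - θ₁) * (lam - t)
          - t * θt * (lam - 1)) * mu
      + kappa1 θ₀ θ₁ θt θi * (kappa1 θ₀ θ₁ θt θi * (lam - t + 1) + θ₀ - (t - 1) * θt))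

def ut (t θ₀ θ₁ θt θi lam mu : ℂ) : ℂ :=
  -θt + (lam - t) / (t * (t - 1) * θi) *
    (lam * (lam - 1) * (lam - t) * mu ^ 2
      + (2 * kappa1 θ₀ θ₁ θt θi * (lam - 1) * (lam - t) - θ₁ * (lam - t)
          + t * (θi - θt) * (lam - 1)) * mu
      + kappa1 θ₀ θ₁ θt θi *
          (kappa1 θ₀ θ₁ θt θi * (lam - t + 1) + θ₀ + (t - 1) * (θi - θt)))

/-- The residue matrix `((u + θ, -w), (u (u + θ) / w, -u))`. -/
def residueMatrix (u θ w : ℂ) : Matrix (Fin 2) (Fin 2) ℂ :=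
  !![u + θ, -w; u * (u + θ) / w, -u]

/-- The coefficient matrix `A(z) = A₀ / z + A₁ / (z - 1) + A_t / (z - t)` of the system
`D_Y(θ₀, θ₁, θ_t, θ_∞; λ, μ; k)`. -/
def coeffMatrix (t θ₀ θ₁ θt θi lam mu k z : ℂ) : Matrix (Fin 2) (Fin 2) ℂ :=
  z⁻¹ • residueMatrix (u0 t θ₀ θ₁ θt θi lam mu) θ₀ (k * lam / t)
  + (z - 1)⁻¹ • residueMatrix (u1 t θ₀ θ₁ θt θi lam mu) θ₁ (-(k * (lam - 1)) / (t - 1))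
  + (z - t)⁻¹ • residueMatrix (ut t θ₀ θ₁ θt θi lam mu) θt (k * (lam - t) / (t * (t - 1)))

/-- `Y` satisfies the system `D_Y(θ₀, θ₁, θ_t, θ_∞; λ, μ; k)` at the point `z`. -/
def SolvesAt (t θ₀ θ₁ θt θi lam mu k : ℂ) (Y : ℂ → Fin 2 → ℂ) (z : ℂ) : Prop :=
  HasDerivAt Y (coeffMatrix t θ₀ θ₁ θt θi lam mu k z *ᵥ Y z) z

/-- The loop at `p` that runs once anticlockwise around the circle with centre `c` through `p`. -/
def circleLoop (c p : ℂ) : Path p p where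
  toFun s := c + (p - c) * Complex.exp (2 * Real.pi * Complex.I * ((s : ℝ) : ℂ))
  continuous_toFun := by fun_prop
  source' := by simp
  target' := by simp

/-- `IsCycle S i α`: the loop `α` is a cycle in `ℂ \ S` turning once anticlockwise around the point
`i` of the Riemann sphere. It runs along a `C¹` path `τ` in `ℂ \ S` from the base point to a point
`p`, once around a circle through `p` which separates `i` from the other points of `S ∪ {∞}`,
and back along `τ`. For `i = ∞`, anticlockwise as seen from `∞` is clockwise in the plane. -/
def IsCycle (S : Set ℂ) {o : ℂ} (i : OnePoint ℂ) (α : Path o o) : Prop :=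
  ∃ (p : ℂ) (τ : Path o p),
    ContDiffOn ℝ 1 τ.extend (Icc 0 1) ∧ (∀ s : I, τ s ∉ S) ∧
    ((∃ c : ℂ, i = (c : OnePoint ℂ) ∧ p ≠ c ∧ Metric.closedBall c (dist p c) ∩ S = {c} ∧
        α = (τ.trans (circleLoop c p)).trans τ.symm) ∨
      (i = OnePoint.infty ∧ S ⊆ Metric.ball 0 (dist p 0) ∧
        α = (τ.trans (circleLoop 0 p).symm).trans τ.symm))

/-- The Pochhammer contour `[α, β] = α⁻¹ β⁻¹ α β`. -/
def pochhammer {o : ℂ} (α β : Path o o) : Path o o :=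
  (α.symm.trans β.symm).trans (α.trans β)

/-- `f` is the analytic continuation along `γ : [0, 1] → ℂ` of the germ of `Y` at `γ 0`: each
`f s` is a function element at `γ s`, neighbouring elements agree, and `f` starts with `Y`. -/
structure IsContinuation (γ : ℝ → ℂ) (Y : ℂ → Fin 2 → ℂ) (f : ℝ → ℂ → Fin 2 → ℂ) : Prop where
  start : f 0 =ᶠ[𝓝 (γ 0)] Y
  analytic : ∀ s ∈ Icc (0 : ℝ) 1, AnalyticAt ℂ (f s) (γ s)
  compat : ∀ s ∈ Icc (0 : ℝ) 1, ∀ᶠ s' in 𝓝[Icc (0 : ℝ) 1] s, f s' =ᶠ[𝓝 (γ s')] f s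

/-- The integrand of
`∫_γ {κ₁ y₁(w) + (w - λ̃) dy₁(w)/dw} (z - w)^κ₁ / (w - λ) dw`, pulled back along the path `γ`, where
`y₁` is continued along `γ` through the function elements `f s`, and `(z - w)^κ₁ = exp (κ₁ ℓ)` with
`ℓ` the chosen branch of `log (z - w)` along `γ`. -/
def integrand1 (κ₁ lam lamt : ℂ) (γ : ℝ → ℂ) (f : ℝ → ℂ → Fin 2 → ℂ) (ℓ : ℝ → ℂ) (s : ℝ) : ℂ :=
  (κ₁ * f s (γ s) 0 + (γ s - lamt) * deriv (fun w => f s w 0) (γ s))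
    * (Complex.exp (κ₁ * ℓ s) / (γ s - lam)) * deriv γ s

/-- The integrand of `∫_γ dy₂(w)/dw (z - w)^κ₁ dw`, pulled back along the path `γ`. -/
def integrand2 (κ₁ : ℂ) (γ : ℝ → ℂ) (f : ℝ → ℂ → Fin 2 → ℂ) (ℓ : ℝ → ℂ) (s : ℝ) : ℂ :=
  deriv (fun w => f s w 1) (γ s) * Complex.exp (κ₁ * ℓ s) * deriv γ s

end

end FuchsianMC

open FuchsianMC

namespace FuchsianMC
-- Algebra of the parameters
variable {t θ₀ θ₁ θt θi lam mu k : ℂ}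

/-! Write `A` and `B` for the coefficient matrices of the given and of the transformed system, and κ
for κ₁. Both integrands are components of `C(w) Y(w) (z - w)^κ` for a single rational matrix `C =
N₀/w + N₁/(w-1) + N_t/(w-t)`. There is no pole at λ, because the first row of `A(λ)` is `(μ, 0)` and
`λ̃ - λ = κ/μ`.

Everything rests on the identity `κ (C(z) - C(w)) = (z - w) (C(z) A(w) - B(z) C(w))`, the first
clause of `exists_kernel`. It follows from the residue relations `N_i A_j = B_i N_j` for `i ≠ j` and
`N_i A_i + κ N_i = B_i N_i`. All these matrices are of rank at most one, so each off-diagonal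
relation comes down to one scalar identity in the parameters, verified from the explicit `u_i` and
`w_i`; the diagonal ones are automatic.

Divided by `z - w`, the identity turns the `z`-derivative of the integrand into `B(z) C(w) Y(w) (z -
w)^κ` minus `C(z)` times the `w`-derivative of `Y(w) (z - w)^κ`. The second term integrates to zero
as soon as `Y(w) (z - w)^κ` comes back to its initial value along the contour. The solution comes
back because `A` is holomorphic at `z`, so that continuation along `α_z`, hence along the
commutator, is trivial (`IsCycle.eventuallyEq_of_holomorphic`,
`IsContinuationOn.pochhammer_eventuallyEq`); nothing is needed about its monodromy along `α_i`. The
logarithm comes back because its increments add up to zero over a commutator (`pochhammer_log_eq`).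

The analytic difficulty is that the contour depends on `z` only continuously, so the pulled back
integrand need not be differentiable in `z`. `hasDerivAt_integral_deformation` works instead with
local primitives chained along the path, and `hasDerivAt_eulerTransform` combines it with the kernel
identity. -/

lemma kappa1_dual : kappa1 (kappa1 θ₀ θ₁ θt θi + θ₀) (kappa1 θ₀ θ₁ θt θi + θ₁)
    (kappa1 θ₀ θ₁ θt θi + θt) (-kappa2 θ₀ θ₁ θt θi) = -kappa1 θ₀ θ₁ θt θi := by
  unfold kappa1 kappa2; ring

/-- Taking `m = -κ₂` as a free parameter in place of θ_t removes the halves and makes the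
denominators κ₂ and θ_∞ independent variables, so that the later identities are within reach of
`field_simp` and `ring`. -/
lemma exists_kappa_eq : ∃ m, kappa2 θ₀ θ₁ θt θi = -m ∧ kappa1 θ₀ θ₁ θt θi = θi - m ∧
    θt = 2 * m - θi - θ₀ - θ₁ :=
  ⟨-kappa2 θ₀ θ₁ θt θi, by ring, by unfold kappa1 kappa2; ring, by unfold kappa2; ring⟩

/-- The factor is the same for all three `u_i`. It is the constant in front of the integral for
`ỹ₂`, and this makes the image of the transformed residue `B_i` contain that of the kernel residue
`N_i`. -/
lemma u0_dual (ht : t ≠ 0) (ht1 : t - 1 ≠ 0) (hmu : mu ≠ 0) (hθi : θi ≠ 0)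
    (hκ₂ : kappa2 θ₀ θ₁ θt θi ≠ 0) :
    u0 t (kappa1 θ₀ θ₁ θt θi + θ₀) (kappa1 θ₀ θ₁ θt θi + θ₁) (kappa1 θ₀ θ₁ θt θi + θt)
      (-kappa2 θ₀ θ₁ θt θi) (lam + kappa1 θ₀ θ₁ θt θi / mu) mu
      = -θi / kappa2 θ₀ θ₁ θt θi * u0 t θ₀ θ₁ θt θi lam mu := by
  unfold u0
  rw [kappa1_dual]
  obtain ⟨m, hm, hK, rfl⟩ := exists_kappa_eq (θ₀ := θ₀) (θ₁ := θ₁) (θt := θt) (θi := θi)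
  rw [hm] at hκ₂
  rw [hm, hK]
  have hm0 : m ≠ 0 := by simpa using hκ₂
  -- The denominator `t - 1` becomes an atom.
  obtain ⟨s, rfl⟩ : ∃ s, t = s + 1 := ⟨t - 1, by ring⟩
  simp only [add_sub_cancel_right] at *
  field_simp
  ring

lemma u1_dual (ht : t ≠ 0) (ht1 : t - 1 ≠ 0) (hmu : mu ≠ 0) (hθi : θi ≠ 0)
    (hκ₂ : kappa2 θ₀ θ₁ θt θi ≠ 0) :
    u1 t (kappa1 θ₀ θ₁ θt θi + θ₀) (kappa1 θ₀ θ₁ θt θi + θ₁) (kappa1 θ₀ θ₁ θt θi + θt)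
      (-kappa2 θ₀ θ₁ θt θi) (lam + kappa1 θ₀ θ₁ θt θi / mu) mu
      = -θi / kappa2 θ₀ θ₁ θt θi * u1 t θ₀ θ₁ θt θi lam mu := by
  unfold u1
  rw [kappa1_dual]
  obtain ⟨m, hm, hK, rfl⟩ := exists_kappa_eq (θ₀ := θ₀) (θ₁ := θ₁) (θt := θt) (θi := θi)
  rw [hm] at hκ₂
  rw [hm, hK]
  have hm0 : m ≠ 0 := by simpa using hκ₂
  obtain ⟨s, rfl⟩ : ∃ s, t = s + 1 := ⟨t - 1, by ring⟩
  simp only [add_sub_cancel_right] at *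
  field_simp
  ring

lemma ut_dual (ht : t ≠ 0) (ht1 : t - 1 ≠ 0) (hmu : mu ≠ 0) (hθi : θi ≠ 0)
    (hκ₂ : kappa2 θ₀ θ₁ θt θi ≠ 0) :
    ut t (kappa1 θ₀ θ₁ θt θi + θ₀) (kappa1 θ₀ θ₁ θt θi + θ₁) (kappa1 θ₀ θ₁ θt θi + θt)
      (-kappa2 θ₀ θ₁ θt θi) (lam + kappa1 θ₀ θ₁ θt θi / mu) mu
      = -θi / kappa2 θ₀ θ₁ θt θi * ut t θ₀ θ₁ θt θi lam mu := by
  unfold ut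
  rw [kappa1_dual]
  obtain ⟨m, hm, hK, rfl⟩ := exists_kappa_eq (θ₀ := θ₀) (θ₁ := θ₁) (θt := θt) (θi := θi)
  rw [hm] at hκ₂
  rw [hm, hK]
  have hm0 : m ≠ 0 := by simpa using hκ₂
  obtain ⟨s, rfl⟩ : ∃ s, t = s + 1 := ⟨t - 1, by ring⟩
  simp only [add_sub_cancel_right] at *
  field_simp
  ring

/-- The `(1, 1)` entry of `A(λ)` is `μ`. -/
lemma sum_residue_div (ht : t ≠ 0) (ht1 : t - 1 ≠ 0) (hθi : θi ≠ 0) (h0 : lam ≠ 0)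
    (h1 : lam - 1 ≠ 0) (h2 : lam - t ≠ 0) :
    (u0 t θ₀ θ₁ θt θi lam mu + θ₀) / lam + (u1 t θ₀ θ₁ θt θi lam mu + θ₁) / (lam - 1)
      + (ut t θ₀ θ₁ θt θi lam mu + θt) / (lam - t) = mu := by
  unfold u0 u1 ut
  obtain ⟨m, hm, hK, rfl⟩ := exists_kappa_eq (θ₀ := θ₀) (θ₁ := θ₁) (θt := θt) (θi := θi)
  rw [hK]
  obtain ⟨s, rfl⟩ : ∃ s, t = s + 1 := ⟨t - 1, by ring⟩
  simp only [add_sub_cancel_right] at *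
  field_simp
  ring

/-- One of six scalar conditions, one for each ordered pair of distinct finite singular points. It
is what remains of `N₀ A₁ = B₀ N₁` after the common column and row of these rank one products are
cancelled; see `kernelResidue_mul`. -/
lemma residue_cross_01 (ht : t ≠ 0) (ht1 : t - 1 ≠ 0) (hmu : mu ≠ 0) (hk : k ≠ 0) (hθi : θi ≠ 0)
    (hκ₂ : kappa2 θ₀ θ₁ θt θi ≠ 0) (h0 : lam ≠ 0) (h1 : lam - 1 ≠ 0) (h2 : lam - t ≠ 0) :
    ((0 - (lam + kappa1 θ₀ θ₁ θt θi / mu)) / (0 - lam)) * (u0 t θ₀ θ₁ θt θi lam mu + θ₀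
        - (k * lam / t) * (u1 t θ₀ θ₁ θt θi lam mu / (-(k * (lam - 1)) / (t - 1))))
      = (-θi / kappa2 θ₀ θ₁ θt θi * u0 t θ₀ θ₁ θt θi lam mu + (kappa1 θ₀ θ₁ θt θi + θ₀))
          * ((1 - (lam + kappa1 θ₀ θ₁ θt θi / mu)) / (1 - lam))
        - ((0 - (lam + kappa1 θ₀ θ₁ θt θi / mu)) / (0 - lam)) * (k * lam / t) *
          (-θi / kappa2 θ₀ θ₁ θt θi * u1 t θ₀ θ₁ θt θi lam mu / (-(k * (lam - 1)) / (t - 1))) := by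
  unfold u0 u1
  have h0' : (0 : ℂ) - lam ≠ 0 := by simpa using h0
  have h1' : 1 - lam ≠ 0 := fun h => h1 (by linear_combination -h)
  have h2' : t - lam ≠ 0 := fun h => h2 (by linear_combination -h)
  obtain ⟨m, hm, hK, rfl⟩ := exists_kappa_eq (θ₀ := θ₀) (θ₁ := θ₁) (θt := θt) (θi := θi)
  rw [hm] at hκ₂
  rw [hm, hK]
  have hm0 : m ≠ 0 := by simpa using hκ₂
  field_simp
  ring

lemma residue_cross_0t (ht : t ≠ 0) (ht1 : t - 1 ≠ 0) (hmu : mu ≠ 0) (hk : k ≠ 0) (hθi : θi ≠ 0)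
    (hκ₂ : kappa2 θ₀ θ₁ θt θi ≠ 0) (h0 : lam ≠ 0) (h1 : lam - 1 ≠ 0) (h2 : lam - t ≠ 0) :
    ((0 - (lam + kappa1 θ₀ θ₁ θt θi / mu)) / (0 - lam)) * (u0 t θ₀ θ₁ θt θi lam mu + θ₀
        - (k * lam / t) * (ut t θ₀ θ₁ θt θi lam mu / (k * (lam - t) / (t * (t - 1)))))
      = (-θi / kappa2 θ₀ θ₁ θt θi * u0 t θ₀ θ₁ θt θi lam mu + (kappa1 θ₀ θ₁ θt θi + θ₀))
          * ((t - (lam + kappa1 θ₀ θ₁ θt θi / mu)) / (t - lam))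
        - ((0 - (lam + kappa1 θ₀ θ₁ θt θi / mu)) / (0 - lam)) * (k * lam / t) *
          (-θi / kappa2 θ₀ θ₁ θt θi * ut t θ₀ θ₁ θt θi lam mu / (k * (lam - t) / (t * (t - 1)))) := by
  unfold u0 ut
  have h0' : (0 : ℂ) - lam ≠ 0 := by simpa using h0
  have h1' : 1 - lam ≠ 0 := fun h => h1 (by linear_combination -h)
  have h2' : t - lam ≠ 0 := fun h => h2 (by linear_combination -h)
  obtain ⟨m, hm, hK, rfl⟩ := exists_kappa_eq (θ₀ := θ₀) (θ₁ := θ₁) (θt := θt) (θi := θi)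
  rw [hm] at hκ₂
  rw [hm, hK]
  have hm0 : m ≠ 0 := by simpa using hκ₂
  field_simp
  ring

lemma residue_cross_10 (ht : t ≠ 0) (ht1 : t - 1 ≠ 0) (hmu : mu ≠ 0) (hk : k ≠ 0) (hθi : θi ≠ 0)
    (hκ₂ : kappa2 θ₀ θ₁ θt θi ≠ 0) (h0 : lam ≠ 0) (h1 : lam - 1 ≠ 0) (h2 : lam - t ≠ 0) :
    ((1 - (lam + kappa1 θ₀ θ₁ θt θi / mu)) / (1 - lam)) * (u1 t θ₀ θ₁ θt θi lam mu + θ₁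
        - (-(k * (lam - 1)) / (t - 1)) * (u0 t θ₀ θ₁ θt θi lam mu / (k * lam / t)))
      = (-θi / kappa2 θ₀ θ₁ θt θi * u1 t θ₀ θ₁ θt θi lam mu + (kappa1 θ₀ θ₁ θt θi + θ₁))
          * ((0 - (lam + kappa1 θ₀ θ₁ θt θi / mu)) / (0 - lam))
        - ((1 - (lam + kappa1 θ₀ θ₁ θt θi / mu)) / (1 - lam)) * (-(k * (lam - 1)) / (t - 1)) *
          (-θi / kappa2 θ₀ θ₁ θt θi * u0 t θ₀ θ₁ θt θi lam mu / (k * lam / t)) := by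
  unfold u1 u0
  have h0' : (0 : ℂ) - lam ≠ 0 := by simpa using h0
  have h1' : 1 - lam ≠ 0 := fun h => h1 (by linear_combination -h)
  have h2' : t - lam ≠ 0 := fun h => h2 (by linear_combination -h)
  obtain ⟨m, hm, hK, rfl⟩ := exists_kappa_eq (θ₀ := θ₀) (θ₁ := θ₁) (θt := θt) (θi := θi)
  rw [hm] at hκ₂
  rw [hm, hK]
  have hm0 : m ≠ 0 := by simpa using hκ₂
  field_simp
  ring

lemma residue_cross_1t (ht : t ≠ 0) (ht1 : t - 1 ≠ 0) (hmu : mu ≠ 0) (hk : k ≠ 0) (hθi : θi ≠ 0)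
    (hκ₂ : kappa2 θ₀ θ₁ θt θi ≠ 0) (h0 : lam ≠ 0) (h1 : lam - 1 ≠ 0) (h2 : lam - t ≠ 0) :
    ((1 - (lam + kappa1 θ₀ θ₁ θt θi / mu)) / (1 - lam)) * (u1 t θ₀ θ₁ θt θi lam mu + θ₁
        - (-(k * (lam - 1)) / (t - 1)) * (ut t θ₀ θ₁ θt θi lam mu / (k * (lam - t) / (t * (t - 1)))))
      = (-θi / kappa2 θ₀ θ₁ θt θi * u1 t θ₀ θ₁ θt θi lam mu + (kappa1 θ₀ θ₁ θt θi + θ₁))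
          * ((t - (lam + kappa1 θ₀ θ₁ θt θi / mu)) / (t - lam))
        - ((1 - (lam + kappa1 θ₀ θ₁ θt θi / mu)) / (1 - lam)) * (-(k * (lam - 1)) / (t - 1)) *
          (-θi / kappa2 θ₀ θ₁ θt θi * ut t θ₀ θ₁ θt θi lam mu / (k * (lam - t) / (t * (t - 1)))) := by
  unfold u1 ut
  have h0' : (0 : ℂ) - lam ≠ 0 := by simpa using h0
  have h1' : 1 - lam ≠ 0 := fun h => h1 (by linear_combination -h)
  have h2' : t - lam ≠ 0 := fun h => h2 (by linear_combination -h)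
  obtain ⟨m, hm, hK, rfl⟩ := exists_kappa_eq (θ₀ := θ₀) (θ₁ := θ₁) (θt := θt) (θi := θi)
  rw [hm] at hκ₂
  rw [hm, hK]
  have hm0 : m ≠ 0 := by simpa using hκ₂
  field_simp
  ring

lemma residue_cross_t0 (ht : t ≠ 0) (ht1 : t - 1 ≠ 0) (hmu : mu ≠ 0) (hk : k ≠ 0) (hθi : θi ≠ 0)
    (hκ₂ : kappa2 θ₀ θ₁ θt θi ≠ 0) (h0 : lam ≠ 0) (h1 : lam - 1 ≠ 0) (h2 : lam - t ≠ 0) :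
    ((t - (lam + kappa1 θ₀ θ₁ θt θi / mu)) / (t - lam)) * (ut t θ₀ θ₁ θt θi lam mu + θt
        - (k * (lam - t) / (t * (t - 1))) * (u0 t θ₀ θ₁ θt θi lam mu / (k * lam / t)))
      = (-θi / kappa2 θ₀ θ₁ θt θi * ut t θ₀ θ₁ θt θi lam mu + (kappa1 θ₀ θ₁ θt θi + θt))
          * ((0 - (lam + kappa1 θ₀ θ₁ θt θi / mu)) / (0 - lam))
        - ((t - (lam + kappa1 θ₀ θ₁ θt θi / mu)) / (t - lam)) * (k * (lam - t) / (t * (t - 1))) *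
          (-θi / kappa2 θ₀ θ₁ θt θi * u0 t θ₀ θ₁ θt θi lam mu / (k * lam / t)) := by
  unfold ut u0
  have h0' : (0 : ℂ) - lam ≠ 0 := by simpa using h0
  have h1' : 1 - lam ≠ 0 := fun h => h1 (by linear_combination -h)
  have h2' : t - lam ≠ 0 := fun h => h2 (by linear_combination -h)
  obtain ⟨m, hm, hK, rfl⟩ := exists_kappa_eq (θ₀ := θ₀) (θ₁ := θ₁) (θt := θt) (θi := θi)
  rw [hm] at hκ₂
  rw [hm, hK]
  have hm0 : m ≠ 0 := by simpa using hκ₂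
  field_simp
  ring

lemma residue_cross_t1 (ht : t ≠ 0) (ht1 : t - 1 ≠ 0) (hmu : mu ≠ 0) (hk : k ≠ 0) (hθi : θi ≠ 0)
    (hκ₂ : kappa2 θ₀ θ₁ θt θi ≠ 0) (h0 : lam ≠ 0) (h1 : lam - 1 ≠ 0) (h2 : lam - t ≠ 0) :
    ((t - (lam + kappa1 θ₀ θ₁ θt θi / mu)) / (t - lam)) * (ut t θ₀ θ₁ θt θi lam mu + θt
        - (k * (lam - t) / (t * (t - 1))) * (u1 t θ₀ θ₁ θt θi lam mu / (-(k * (lam - 1)) / (t - 1))))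
      = (-θi / kappa2 θ₀ θ₁ θt θi * ut t θ₀ θ₁ θt θi lam mu + (kappa1 θ₀ θ₁ θt θi + θt))
          * ((1 - (lam + kappa1 θ₀ θ₁ θt θi / mu)) / (1 - lam))
        - ((t - (lam + kappa1 θ₀ θ₁ θt θi / mu)) / (t - lam)) * (k * (lam - t) / (t * (t - 1))) *
          (-θi / kappa2 θ₀ θ₁ θt θi * u1 t θ₀ θ₁ θt θi lam mu / (-(k * (lam - 1)) / (t - 1))) := by
  unfold ut u1
  have h0' : (0 : ℂ) - lam ≠ 0 := by simpa using h0
  have h1' : 1 - lam ≠ 0 := fun h => h1 (by linear_combination -h)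
  have h2' : t - lam ≠ 0 := fun h => h2 (by linear_combination -h)
  obtain ⟨m, hm, hK, rfl⟩ := exists_kappa_eq (θ₀ := θ₀) (θ₁ := θ₁) (θt := θt) (θi := θi)
  rw [hm] at hκ₂
  rw [hm, hK]
  have hm0 : m ≠ 0 := by simpa using hκ₂
  field_simp
  ring

/-! ### The kernel and its intertwining relation -/

variable {t θ₀ θ₁ θt θi lam mu k : ℂ}

/-- The rational function with simple poles at `0`, `1`, `t` and the given residues. -/
noncomputable def partialFractions (t : ℂ) {M : Type*} [AddCommGroup M] [Module ℂ M] (M₀ M₁ Mt : M) (z : ℂ) : M :=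
  z⁻¹ • M₀ + (z - 1)⁻¹ • M₁ + (z - t)⁻¹ • Mt

/-- The residues of the kernel transforming a solution into the integrand. -/
noncomputable def kernelResidue (p q u θ w : ℂ) : Matrix (Fin 2) (Fin 2) ℂ :=
  !![p * (u + θ), -(p * w); q * (u * (u + θ) / w), -(q * u)]

/-- A residue matrix is the column `(1, u/w)` times the row `(u + θ, -w)`, and the kernel residue is
`diag(p, q)` times it. Both products are therefore multiples of the same column times the row `(u' +
θ', -w')`, and `h` equates the two scalar factors. -/
lemma kernelResidue_mul {p p' q κ u u' θ θ' w w' : ℂ} (hp : p ≠ 0) (hw : w ≠ 0) (hw' : w' ≠ 0)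
    (h : p * (u + θ - w * (u' / w')) = (q * u + (κ + θ)) * p' - p * w * (q * u' / w')) :
    kernelResidue p q u θ w * residueMatrix u' θ' w'
      = residueMatrix (q * u) (κ + θ) (p * w) * kernelResidue p' q u' θ' w' := by
  unfold kernelResidue residueMatrix
  ext a b
  fin_cases a <;> fin_cases b <;> simp [Matrix.mul_apply, Fin.sum_univ_two]
  · linear_combination (u' + θ') * h
  · field_simp at h ⊢
    linear_combination -h
  · field_simp at h ⊢
    linear_combination (u' + θ') * q * u * h
  · field_simp at h ⊢
    linear_combination -q * u * h

/-- The rows of the kernel residue are left eigenvectors of the first residue matrix for its trace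
`θ`, and its columns are eigenvectors of the second for its trace `κ + θ`. -/
lemma kernelResidue_mul_self {p q κ u θ w : ℂ} (hp : p ≠ 0) (hw : w ≠ 0) :
    kernelResidue p q u θ w * residueMatrix u θ w + κ • kernelResidue p q u θ w
      = residueMatrix (q * u) (κ + θ) (p * w) * kernelResidue p q u θ w := by
  unfold kernelResidue residueMatrix
  ext a b
  fin_cases a <;> fin_cases b <;> simp [Matrix.mul_apply, Fin.sum_univ_two] <;> field_simp <;> ring

/-- In the double sum over pairs of poles the off-diagonal terms cancel and the diagonal ones leave
`-κ N_i / ((z - i)(w - i))`. The factor `z - w` splits this by `(z - w)/((z - i)(w - i)) = 1/(w - i)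
- 1/(z - i)`. -/
lemma partialFractions_intertwine {R : Type*} [Ring R] [Algebra ℂ R]
    {N₀ N₁ Nt A₀ A₁ At B₀ B₁ Bt : R} {κ : ℂ}
    (h00 : N₀ * A₀ + κ • N₀ = B₀ * N₀) (h11 : N₁ * A₁ + κ • N₁ = B₁ * N₁)
    (htt : Nt * At + κ • Nt = Bt * Nt)
    (h01 : N₀ * A₁ = B₀ * N₁) (h0t : N₀ * At = B₀ * Nt) (h10 : N₁ * A₀ = B₁ * N₀)
    (h1t : N₁ * At = B₁ * Nt) (ht0 : Nt * A₀ = Bt * N₀) (ht1 : Nt * A₁ = Bt * N₁)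
    {z w : ℂ} (hz : z ∉ ({0, 1, t} : Set ℂ)) (hw : w ∉ ({0, 1, t} : Set ℂ)) :
    κ • (partialFractions t N₀ N₁ Nt z - partialFractions t N₀ N₁ Nt w)
      = (z - w) • (partialFractions t N₀ N₁ Nt z * partialFractions t A₀ A₁ At w
        - partialFractions t B₀ B₁ Bt z * partialFractions t N₀ N₁ Nt w) := by
  simp only [mem_insert_iff, mem_singleton_iff, not_or] at hz hw
  obtain ⟨z0, z1, z2⟩ := hz
  obtain ⟨w0, w1, w2⟩ := hw
  rw [← ne_eq, ← sub_ne_zero] at z1 z2 w1 w2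
  have e0 : (z - w) * (z⁻¹ * w⁻¹) = w⁻¹ - z⁻¹ := by field_simp
  have e1 : (z - w) * ((z - 1)⁻¹ * (w - 1)⁻¹) = (w - 1)⁻¹ - (z - 1)⁻¹ := by field_simp; ring
  have e2 : (z - w) * ((z - t)⁻¹ * (w - t)⁻¹) = (w - t)⁻¹ - (z - t)⁻¹ := by field_simp; ring
  unfold partialFractions
  generalize z⁻¹ = x0 at *
  generalize (z - 1)⁻¹ = x1 at *
  generalize (z - t)⁻¹ = x2 at *
  generalize w⁻¹ = y0 at *
  generalize (w - 1)⁻¹ = y1 at *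
  generalize (w - t)⁻¹ = y2 at *
  simp only [mul_add, add_mul, smul_mul_smul_comm, ← h00, ← h11, ← htt, ← h01, ← h0t, ← h10,
    ← h1t, ← ht0, ← ht1]
  match_scalars
  · linear_combination κ * e0
  · linear_combination κ * e1
  · linear_combination κ * e2
  all_goals ring

lemma coeffMatrix_eq (z : ℂ) : coeffMatrix t θ₀ θ₁ θt θi lam mu k z = partialFractions t
    (residueMatrix (u0 t θ₀ θ₁ θt θi lam mu) θ₀ (k * lam / t))
    (residueMatrix (u1 t θ₀ θ₁ θt θi lam mu) θ₁ (-(k * (lam - 1)) / (t - 1)))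
    (residueMatrix (ut t θ₀ θ₁ θt θi lam mu) θt (k * (lam - t) / (t * (t - 1)))) z := rfl

/-- The kernel `C(w)` transforming a solution `y` into the vector of integrands `C(w) y(w)`
intertwines the system and its transform. -/
theorem exists_kernel (ht : t ≠ 0 ∧ t ≠ 1) (hk : k ≠ 0) (hmu : mu ≠ 0)
    (hθi : θi ≠ 0) (hκ₂ : kappa2 θ₀ θ₁ θt θi ≠ 0)
    (hlam : lam ∉ ({0, 1, t} : Set ℂ))
    (hlamt : lam + kappa1 θ₀ θ₁ θt θi / mu ∉ ({0, 1, t} : Set ℂ)) :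
    ∃ N₀ N₁ Nt : Matrix (Fin 2) (Fin 2) ℂ,
      (∀ z w, z ∉ ({0, 1, t} : Set ℂ) → w ∉ ({0, 1, t} : Set ℂ) →
        kappa1 θ₀ θ₁ θt θi • (partialFractions t N₀ N₁ Nt z - partialFractions t N₀ N₁ Nt w)
          = (z - w) • (partialFractions t N₀ N₁ Nt z * coeffMatrix t θ₀ θ₁ θt θi lam mu k w
            - coeffMatrix t (kappa1 θ₀ θ₁ θt θi + θ₀) (kappa1 θ₀ θ₁ θt θi + θ₁)
              (kappa1 θ₀ θ₁ θt θi + θt) (-kappa2 θ₀ θ₁ θt θi) (lam + kappa1 θ₀ θ₁ θt θi / mu) mu k z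
              * partialFractions t N₀ N₁ Nt w)) ∧
      (∀ w v, w ∉ ({0, 1, t} : Set ℂ) → w ≠ lam →
        (partialFractions t N₀ N₁ Nt w *ᵥ v) 0
          = (kappa1 θ₀ θ₁ θt θi * v 0 + (w - (lam + kappa1 θ₀ θ₁ θt θi / mu))
            * (coeffMatrix t θ₀ θ₁ θt θi lam mu k w *ᵥ v) 0) / (w - lam)) ∧
      ∀ w v, (partialFractions t N₀ N₁ Nt w *ᵥ v) 1
          = -θi / kappa2 θ₀ θ₁ θt θi * (coeffMatrix t θ₀ θ₁ θt θi lam mu k w *ᵥ v) 1 := by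
  obtain ⟨ht0, ht1⟩ := ht
  rw [← sub_ne_zero] at ht1
  simp only [mem_insert_iff, mem_singleton_iff, not_or] at hlam hlamt
  obtain ⟨l0, l1, l2⟩ := hlam
  obtain ⟨m0, m1, m2⟩ := hlamt
  rw [← ne_eq, ← sub_ne_zero] at l1 l2
  have l0' : 0 - lam ≠ 0 := by simpa using l0
  have l1' : 1 - lam ≠ 0 := fun h => l1 (by linear_combination -h)
  have l2' : t - lam ≠ 0 := fun h => l2 (by linear_combination -h)
  have p0 : (0 - (lam + kappa1 θ₀ θ₁ θt θi / mu)) / (0 - lam) ≠ 0 :=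
    div_ne_zero (fun h => m0 (by linear_combination -h)) l0'
  have p1 : (1 - (lam + kappa1 θ₀ θ₁ θt θi / mu)) / (1 - lam) ≠ 0 :=
    div_ne_zero (fun h => m1 (by linear_combination -h)) l1'
  have p2 : (t - (lam + kappa1 θ₀ θ₁ θt θi / mu)) / (t - lam) ≠ 0 :=
    div_ne_zero (fun h => m2 (by linear_combination -h)) l2'
  have w0 : k * lam / t ≠ 0 := by positivity
  have w1 : -(k * (lam - 1)) / (t - 1) ≠ 0 := by
    simp [hk, l1, ht1]
  have w2 : k * (lam - t) / (t * (t - 1)) ≠ 0 := by positivity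
  -- The first factor is the value of `(w - λ̃)/(w - λ)` at the pole, since the first row of the
  -- kernel must have the residues of `(w - λ̃)/(w - λ)` times the first row of `A`. The second is
  -- the constant in front of the integral of `y₂'`.
  refine ⟨kernelResidue ((0 - (lam + kappa1 θ₀ θ₁ θt θi / mu)) / (0 - lam))
      (-θi / kappa2 θ₀ θ₁ θt θi) (u0 t θ₀ θ₁ θt θi lam mu) θ₀ (k * lam / t),
    kernelResidue ((1 - (lam + kappa1 θ₀ θ₁ θt θi / mu)) / (1 - lam))
      (-θi / kappa2 θ₀ θ₁ θt θi) (u1 t θ₀ θ₁ θt θi lam mu) θ₁ (-(k * (lam - 1)) / (t - 1)),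
    kernelResidue ((t - (lam + kappa1 θ₀ θ₁ θt θi / mu)) / (t - lam))
      (-θi / kappa2 θ₀ θ₁ θt θi) (ut t θ₀ θ₁ θt θi lam mu) θt (k * (lam - t) / (t * (t - 1))),
    ?_, ?_, ?_⟩
  · intro z w hz hw
    have q0 : k * (lam + kappa1 θ₀ θ₁ θt θi / mu) / t
        = (0 - (lam + kappa1 θ₀ θ₁ θt θi / mu)) / (0 - lam) * (k * lam / t) := by
      field_simp
      ring
    have q1 : -(k * (lam + kappa1 θ₀ θ₁ θt θi / mu - 1)) / (t - 1)
        = (1 - (lam + kappa1 θ₀ θ₁ θt θi / mu)) / (1 - lam) * (-(k * (lam - 1)) / (t - 1)) := by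
      field_simp
      ring
    have q2 : k * (lam + kappa1 θ₀ θ₁ θt θi / mu - t) / (t * (t - 1))
        = (t - (lam + kappa1 θ₀ θ₁ θt θi / mu)) / (t - lam) * (k * (lam - t) / (t * (t - 1))) := by
      field_simp
      ring
    rw [coeffMatrix_eq, coeffMatrix_eq, u0_dual ht0 ht1 hmu hθi hκ₂, u1_dual ht0 ht1 hmu hθi hκ₂,
      ut_dual ht0 ht1 hmu hθi hκ₂, q0, q1, q2]
    exact partialFractions_intertwine
      (kernelResidue_mul_self p0 w0) (kernelResidue_mul_self p1 w1) (kernelResidue_mul_self p2 w2)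
      (kernelResidue_mul p0 w0 w1 (residue_cross_01 ht0 ht1 hmu hk hθi hκ₂ l0 l1 l2))
      (kernelResidue_mul p0 w0 w2 (residue_cross_0t ht0 ht1 hmu hk hθi hκ₂ l0 l1 l2))
      (kernelResidue_mul p1 w1 w0 (residue_cross_10 ht0 ht1 hmu hk hθi hκ₂ l0 l1 l2))
      (kernelResidue_mul p1 w1 w2 (residue_cross_1t ht0 ht1 hmu hk hθi hκ₂ l0 l1 l2))
      (kernelResidue_mul p2 w2 w0 (residue_cross_t0 ht0 ht1 hmu hk hθi hκ₂ l0 l1 l2))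
      (kernelResidue_mul p2 w2 w1 (residue_cross_t1 ht0 ht1 hmu hk hθi hκ₂ l0 l1 l2)) hz hw
  · intro w v hw hwl
    simp only [mem_insert_iff, mem_singleton_iff, not_or] at hw
    obtain ⟨n0, n1, n2⟩ := hw
    rw [← ne_eq, ← sub_ne_zero] at n1 n2
    rw [← sub_ne_zero] at hwl
    have hs := sum_residue_div (θ₀ := θ₀) (θ₁ := θ₁) (θt := θt) (mu := mu) ht0 ht1 hθi l0 l1 l2
    rw [coeffMatrix_eq]
    generalize u0 t θ₀ θ₁ θt θi lam mu = a0 at *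
    generalize u1 t θ₀ θ₁ θt θi lam mu = a1 at *
    generalize ut t θ₀ θ₁ θt θi lam mu = a2 at *
    -- The `(1, 2)` entry of `A(λ)` vanishes. With `hs` this makes the numerator `κ₁ y₁ + (w - λ̃)
    -- y₁'` vanish at `w = λ`.
    have hT : k * lam / t / lam + -(k * (lam - 1)) / (t - 1) / (lam - 1)
        + k * (lam - t) / (t * (t - 1)) / (lam - t) = 0 := by
      field_simp
      ring
    generalize k * lam / t = b0 at *
    generalize -(k * (lam - 1)) / (t - 1) = b1 at *
    generalize k * (lam - t) / (t * (t - 1)) = b2 at *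
    generalize kappa1 θ₀ θ₁ θt θi = K at *
    have e0 : (0 - (lam + K / mu)) / (0 - lam) * w⁻¹
        = ((w - (lam + K / mu)) * w⁻¹ + K / mu / lam) / (w - lam) := by
      field_simp
      ring
    have e1 : (1 - (lam + K / mu)) / (1 - lam) * (w - 1)⁻¹
        = ((w - (lam + K / mu)) * (w - 1)⁻¹ + K / mu / (lam - 1)) / (w - lam) := by
      field_simp
      ring
    have e2 : (t - (lam + K / mu)) / (t - lam) * (w - t)⁻¹
        = ((w - (lam + K / mu)) * (w - t)⁻¹ + K / mu / (lam - t)) / (w - lam) := by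
      field_simp
      ring
    simp only [partialFractions, kernelResidue, residueMatrix, Matrix.mulVec, dotProduct,
      Fin.sum_univ_two, Matrix.add_apply, Matrix.smul_apply, smul_eq_mul, Matrix.of_apply,
      Matrix.cons_val_zero, Matrix.cons_val_one, Matrix.cons_val', Matrix.cons_val_fin_one]
    have hK : K / mu * mu = K := by field_simp
    linear_combination ((a0 + θ₀) * v 0 - b0 * v 1) * e0 + ((a1 + θ₁) * v 0 - b1 * v 1) * e1
      + ((a2 + θt) * v 0 - b2 * v 1) * e2 + (K / mu * v 0 / (w - lam)) * hs
      - (K / mu * v 1 / (w - lam)) * hT + v 0 / (w - lam) * hK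
  · intro w v
    rw [coeffMatrix_eq]
    simp only [partialFractions, kernelResidue, residueMatrix, Matrix.mulVec, dotProduct,
      Fin.sum_univ_two, Matrix.add_apply, Matrix.smul_apply, smul_eq_mul, Matrix.of_apply,
      Matrix.cons_val_zero, Matrix.cons_val_one, Matrix.cons_val', Matrix.cons_val_fin_one]
    ring

/-! ### Holomorphic linear systems on convex sets and discs -/

section ODE

variable {E : Type*} [NormedAddCommGroup E] [NormedSpace ℂ E] {A : ℂ → E →L[ℂ] E}

/-- A solution of a linear system on a convex set is determined by one of its values. -/
theorem eqOn_of_hasDerivAt_linear {V : Set ℂ} (hV : Convex ℝ V) (hA : ContinuousOn A V)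
    {y₁ y₂ : ℂ → E} (h₁ : ∀ w ∈ V, HasDerivAt y₁ (A w (y₁ w)) w)
    (h₂ : ∀ w ∈ V, HasDerivAt y₂ (A w (y₂ w)) w) {p : ℂ} (hp : p ∈ V) (h : y₁ p = y₂ p) :
    EqOn y₁ y₂ V := by
  intro w hw
  -- On the segment from `p` to `w` the system is a real ODE with Lipschitz constant `‖w - p‖ * M`,
  -- where `M` bounds `A` on the segment.
  set g : ℝ → ℂ := fun s => p + (s : ℂ) * (w - p) with hg
  have hgV : ∀ s ∈ Icc (0 : ℝ) 1, g s ∈ V := by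
    intro s hs
    have := hV.add_smul_sub_mem hp hw hs
    simpa only [hg, Complex.real_smul] using this
  have hgd : ∀ s : ℝ, HasDerivAt g (w - p) s := by
    intro s
    simpa [hg] using ((Complex.ofRealCLM.hasDerivAt (x := s)).mul_const (w - p)).const_add p
  have hgc : Continuous g := by fun_prop
  obtain ⟨M, hM⟩ := isCompact_Icc.exists_bound_of_continuousOn (hA.comp hgc.continuousOn hgV)
  have key : ∀ y : ℂ → E, (∀ w ∈ V, HasDerivAt y (A w (y w)) w) →
      ∀ s ∈ Icc (0 : ℝ) 1, HasDerivAt (fun s => y (g s)) ((w - p) • A (g s) (y (g s))) s :=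
    fun y hy s hs => (hy _ (hgV s hs)).scomp s (hgd s)
  have := ODE_solution_unique_of_mem_Icc_right (a := 0) (b := 1)
    (v := fun s x => (w - p) • A (g s) x) (s := fun _ => univ) (K := (‖w - p‖ * M).toNNReal)
    (f := fun s => y₁ (g s)) (g := fun s => y₂ (g s)) ?_
    (fun s hs => (key _ h₁ s hs).continuousAt.continuousWithinAt)
    (fun s hs => (key _ h₁ s (Ico_subset_Icc_self hs)).hasDerivWithinAt) (fun _ _ => mem_univ _)
    (fun s hs => (key _ h₂ s hs).continuousAt.continuousWithinAt)
    (fun s hs => (key _ h₂ s (Ico_subset_Icc_self hs)).hasDerivWithinAt) (fun _ _ => mem_univ _)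
    (by simpa [hg] using h) (right_mem_Icc.2 zero_le_one)
  · simpa [hg] using this
  · intro s hs
    refine LipschitzOnWith.of_dist_le_mul fun x _ y _ => ?_
    rw [dist_eq_norm, dist_eq_norm, ← smul_sub, ← map_sub, norm_smul, Real.coe_toNNReal']
    have h1 : ‖A (g s) (x - y)‖ ≤ M * ‖x - y‖ :=
      (A (g s)).le_of_opNorm_le (hM s (Ico_subset_Icc_self hs)) _
    calc ‖w - p‖ * ‖A (g s) (x - y)‖ ≤ ‖w - p‖ * (M * ‖x - y‖) := by gcongr
      _ = ‖w - p‖ * M * ‖x - y‖ := by ring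
      _ ≤ _ := by gcongr; exact le_max_left _ _

/-- A holomorphic linear system with bounded coefficients on a disc has solutions on this disc
with any initial value. -/
theorem exists_hasDerivAt_linear [CompleteSpace E] {c : ℂ} {R M : ℝ}
    (hA : DifferentiableOn ℂ A (Metric.ball c R)) (hM : ∀ w ∈ Metric.ball c R, ‖A w‖ ≤ M)
    {p : ℂ} (hp : p ∈ Metric.ball c R) (y₀ : E) :
    ∃ y : ℂ → E, y p = y₀ ∧ ∀ w ∈ Metric.ball c R, HasDerivAt y (A w (y w)) w := by
  set V := Metric.ball c R
  have hM0 : 0 ≤ M := (norm_nonneg _).trans (hM p hp)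
  -- Picard iteration: `G` is the primitive of `A g` vanishing at `p`, which exists because
  -- holomorphic functions on a disc are exact. The solution is the sum of all iterates of the
  -- constant `y₀`.
  have step : ∀ g : {g : ℂ → E // DifferentiableOn ℂ g V}, ∃ G : {g : ℂ → E // DifferentiableOn ℂ g V},
      G.1 p = 0 ∧ ∀ x ∈ V, HasDerivAt G.1 (A x (g.1 x)) x := by
    intro g
    obtain ⟨G, hG0, hG⟩ := (hA.clm_apply g.2).isExactOn_ball.with_val_at p 0
    exact ⟨⟨G, fun x hx => (hG x hx).differentiableAt.differentiableWithinAt⟩, hG0, hG⟩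
  choose next hnext0 hnext using step
  let Z : ℕ → {g : ℂ → E // DifferentiableOn ℂ g V} := fun n =>
    next^[n] ⟨fun _ => y₀, differentiableOn_const _⟩
  have hZ0 : ∀ w, (Z 0).1 w = y₀ := fun w => rfl
  have hZs : ∀ n, Z (n + 1) = next (Z n) := fun n => Function.iterate_succ_apply' _ _ _
  -- The power of `‖w - p‖` has to be kept in the induction: integrating it along the segment is
  -- what produces the factorial.
  have bound : ∀ n, ∀ w ∈ V, ‖(Z n).1 w‖ ≤ ‖y₀‖ * ((M * ‖w - p‖) ^ n / n.factorial) := by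
    intro n
    induction n with
    | zero => intro w _; simp [hZ0]
    | succ n ih =>
      intro w hw
      set g : ℝ → ℂ := fun s => p + (s : ℂ) * (w - p) with hg
      have hgV : ∀ s ∈ Icc (0 : ℝ) 1, g s ∈ V := by
        intro s hs
        have := (convex_ball c R).add_smul_sub_mem hp hw hs
        simpa only [hg, Complex.real_smul] using this
      have hgd : ∀ s : ℝ, HasDerivAt g (w - p) s := by
        intro s
        simpa [hg] using ((Complex.ofRealCLM.hasDerivAt (x := s)).mul_const (w - p)).const_add p
      have hd : ∀ s ∈ Icc (0 : ℝ) 1, HasDerivAt (fun s => (Z (n + 1)).1 (g s))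
          ((w - p) • A (g s) ((Z n).1 (g s))) s := by
        intro s hs
        rw [hZs]
        exact (hnext (Z n) _ (hgV s hs)).scomp s (hgd s)
      have hB : ∀ s : ℝ, HasDerivAt
          (fun s : ℝ => ‖y₀‖ * ((M * (s * ‖w - p‖)) ^ (n + 1) / (n + 1).factorial))
          (‖w - p‖ * (M * (‖y₀‖ * ((M * (s * ‖w - p‖)) ^ n / n.factorial)))) s := by
        intro s
        have h1 := ((((hasDerivAt_id s).mul_const ‖w - p‖).const_mul M).pow (n + 1)).div_const
          ((n + 1).factorial : ℝ) |>.const_mul ‖y₀‖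
        refine HasDerivAt.congr_deriv (f := fun s : ℝ => ‖y₀‖ *
          ((M * (s * ‖w - p‖)) ^ (n + 1) / (n + 1).factorial)) h1 ?_
        rw [Nat.factorial_succ]
        have : (n.factorial : ℝ) ≠ 0 := by positivity
        have : (n : ℝ) + 1 ≠ 0 := by positivity
        push_cast
        simp only [id]
        field_simp
      have := image_norm_le_of_norm_deriv_right_le_deriv_boundary (a := 0) (b := 1)
        (f := fun s => (Z (n + 1)).1 (g s))
        (fun s hs => (hd s hs).continuousAt.continuousWithinAt)
        (fun s hs => (hd s (Ico_subset_Icc_self hs)).hasDerivWithinAt) ?_ hB ?_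
        (right_mem_Icc.2 zero_le_one)
      · simpa [hg] using this
      · have : (Z (n + 1)).1 p = 0 := by rw [hZs]; exact hnext0 _
        simp [hg, this]
      · intro s hs
        have hs' := Ico_subset_Icc_self hs
        rw [norm_smul]
        gcongr
        refine ((A (g s)).le_of_opNorm_le (hM _ (hgV s hs')) _).trans ?_
        gcongr
        refine (ih _ (hgV s hs')).trans (le_of_eq ?_)
        have : ‖g s - p‖ = s * ‖w - p‖ := by
          simp [hg, abs_of_nonneg hs.1]
        rw [this]
  have hR : ∀ w ∈ V, ‖w - p‖ ≤ 2 * R := by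
    intro w hw
    have h1 : dist w c < R := hw
    have h2 : dist p c < R := hp
    rw [← dist_eq_norm]
    linarith [dist_triangle_right w p c]
  have bound' : ∀ n, ∀ w ∈ V, ‖(Z n).1 w‖ ≤ ‖y₀‖ * ((M * (2 * R)) ^ n / n.factorial) := by
    intro n w hw
    refine (bound n w hw).trans ?_
    gcongr
    exact hR w hw
  have hsum : Summable fun n : ℕ => ‖y₀‖ * ((M * (2 * R)) ^ n / n.factorial) :=
    (Real.summable_pow_div_factorial _).mul_left _
  have hsZ : ∀ w ∈ V, Summable fun n => (Z n).1 w := fun w hw =>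
    Summable.of_norm_bounded hsum fun n => bound' n w hw
  have hp0 : ∀ n, (Z (n + 1)).1 p = 0 := fun n => by rw [hZs]; exact hnext0 _
  -- With the term `Z 0 = y₀` split off, every remaining term vanishes at `p`, and the derivative of
  -- the term `Z (n + 1)` is `A` applied to `Z n`.
  refine ⟨fun w => y₀ + ∑' n, (Z (n + 1)).1 w, by simp [hp0], fun w hw => ?_⟩
  have h := hasDerivAt_tsum_of_isPreconnected (hsum.mul_left M) Metric.isOpen_ball
    (convex_ball c R).isPreconnected (g := fun n w => (Z (n + 1)).1 w)
    (g' := fun n w => A w ((Z n).1 w)) (fun n x hx => by rw [hZs]; exact hnext (Z n) x hx)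
    (fun n x hx => ((A x).le_of_opNorm_le (hM x hx) _).trans
      (mul_le_mul_of_nonneg_left (bound' n x hx) hM0)) hp (by simp [hp0, summable_zero]) hw
  have h2 : A w (y₀ + ∑' n, (Z (n + 1)).1 w) = ∑' n, A w ((Z n).1 w) := by
    rw [← (A w).map_tsum (hsZ w hw), (hsZ w hw).tsum_eq_zero_add, hZ0]
  rw [h2]
  exact h.const_add y₀

end ODE

/-! ### Analytic continuation along a path -/

section Continuation

variable {E : Type*} [NormedAddCommGroup E] [NormedSpace ℂ E]

/-- The identity theorem on a ball where both functions are analytic. It makes equality of germs a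
locally constant condition along a path, so that connectedness of the parameter set applies. -/
lemma AnalyticAt.eventually_eventuallyEq_iff [CompleteSpace E] {f g : ℂ → E} {x : ℂ} (hf : AnalyticAt ℂ f x)
    (hg : AnalyticAt ℂ g x) : ∀ᶠ y in 𝓝 x, (f =ᶠ[𝓝 y] g ↔ f =ᶠ[𝓝 x] g) := by
  obtain ⟨r, hr, hfr⟩ := Metric.eventually_nhds_iff_ball.1
    (hf.eventually_analyticAt.and hg.eventually_analyticAt)
  filter_upwards [Metric.ball_mem_nhds x hr] with y hy
  have aux : ∀ a ∈ Metric.ball x r, ∀ b ∈ Metric.ball x r, f =ᶠ[𝓝 a] g → f =ᶠ[𝓝 b] g := by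
    intro a ha b hb h
    have := AnalyticOnNhd.eqOn_of_preconnected_of_eventuallyEq (fun z hz => (hfr z hz).1)
      (fun z hz => (hfr z hz).2) (convex_ball x r).isPreconnected ha h
    exact this.eventuallyEq_of_mem (Metric.isOpen_ball.mem_nhds hb)
  exact ⟨aux y hy x (Metric.mem_ball_self hr), aux x (Metric.mem_ball_self hr) y hy⟩

/-- A family of function elements along `γ`, parametrized by `T`, in which neighbouring elements
agree. -/
structure IsContinuationOn (γ : ℝ → ℂ) (f : ℝ → ℂ → E) (T : Set ℝ) : Prop where
  continuousOn : ContinuousOn γ T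
  analytic : ∀ s ∈ T, AnalyticAt ℂ (f s) (γ s)
  compat : ∀ s ∈ T, ∀ᶠ s' in 𝓝[T] s, f s' =ᶠ[𝓝 (γ s')] f s

namespace IsContinuationOn

variable {γ : ℝ → ℂ} {f g : ℝ → ℂ → E} {T : Set ℝ}

/-- Uniqueness of analytic continuation along a path. -/
theorem eventuallyEq_iff [CompleteSpace E] (hf : IsContinuationOn γ f T) (hg : IsContinuationOn γ g T)
    (hT : IsPreconnected T) {a b : ℝ} (ha : a ∈ T) (hb : b ∈ T) :
    f a =ᶠ[𝓝 (γ a)] g a ↔ f b =ᶠ[𝓝 (γ b)] g b := by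
  refine hT.induction₂ (fun a b => f a =ᶠ[𝓝 (γ a)] g a ↔ f b =ᶠ[𝓝 (γ b)] g b) ?_
    (fun x y z _ _ _ h h' => h.trans h') (fun x y _ _ h => h.symm) ha hb
  intro s hs
  filter_upwards [hf.compat s hs, hg.compat s hs, (hf.continuousOn s hs).eventually
    (AnalyticAt.eventually_eventuallyEq_iff (hf.analytic s hs) (hg.analytic s hs))]
    with s' h1 h2 h3
  rw [← h3]
  exact ⟨fun h => h1.trans (h.trans h2.symm), fun h => h1.symm.trans (h.trans h2)⟩

theorem comp (hf : IsContinuationOn γ f T) {T' : Set ℝ} {φ : ℝ → ℝ} (hφ : ContinuousOn φ T')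
    (hm : MapsTo φ T' T) {γ' : ℝ → ℂ} (hγ : EqOn γ' (γ ∘ φ) T') :
    IsContinuationOn γ' (f ∘ φ) T' where
  continuousOn := (hf.continuousOn.comp hφ hm).congr hγ
  analytic s hs := by rw [hγ hs]; exact hf.analytic _ (hm hs)
  compat s hs := by
    filter_upwards [(tendsto_nhdsWithin_of_tendsto_nhds_of_eventually_within _ (hφ s hs)
      (eventually_mem_nhdsWithin.mono hm)).eventually (hf.compat _ (hm hs)),
      eventually_mem_nhdsWithin] with s' h hs'
    rw [hγ hs']
    exact h

theorem mono (hf : IsContinuationOn γ f T) {T' : Set ℝ} (h : T' ⊆ T) : IsContinuationOn γ f T' where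
  continuousOn := hf.continuousOn.mono h
  analytic s hs := hf.analytic s (h hs)
  compat s hs := (hf.compat s (h hs)).filter_mono (nhdsWithin_mono _ h)

theorem const (hγ : ContinuousOn γ T) {F : ℂ → E} (hF : ∀ s ∈ T, AnalyticAt ℂ F (γ s)) :
    IsContinuationOn γ (fun _ => F) T :=
  ⟨hγ, hF, fun _ _ => Eventually.of_forall fun _ => EventuallyEq.rfl⟩

/-- Analytic continuation preserves linear differential equations. -/
theorem eventually_hasDerivAt [CompleteSpace E] (hf : IsContinuationOn γ f T) (hT : IsPreconnected T)
    {A : ℂ → E →L[ℂ] E} (hA : ∀ s ∈ T, AnalyticAt ℂ A (γ s)) {a b : ℝ} (ha : a ∈ T) (hb : b ∈ T)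
    (h : ∀ᶠ w in 𝓝 (γ a), HasDerivAt (f a) (A w (f a w)) w) :
    ∀ᶠ w in 𝓝 (γ b), HasDerivAt (f b) (A w (f b w)) w := by
  -- The derivative and `A` applied to the function are both continuations along `γ`; since they
  -- agree at `a`, they agree at `b`.
  have h1 : IsContinuationOn γ (fun s => deriv (f s)) T :=
    ⟨hf.continuousOn, fun s hs => (hf.analytic s hs).deriv,
      fun s hs => (hf.compat s hs).mono fun s' h => h.deriv⟩
  have h2 : IsContinuationOn γ (fun s w => A w (f s w)) T :=
    ⟨hf.continuousOn, fun s hs => by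
        rw [Complex.analyticAt_iff_eventually_differentiableAt]
        filter_upwards [(hA s hs).eventually_analyticAt, (hf.analytic s hs).eventually_analyticAt]
          with w h1 h2
        exact h1.differentiableAt.clm_apply h2.differentiableAt,
      fun s hs => (hf.compat s hs).mono fun s' h => h.mono fun w hw => by simp only [hw]⟩
  have h3 := (h1.eventuallyEq_iff h2 hT ha hb).1 (h.mono fun w hw => hw.deriv)
  filter_upwards [h3, (hf.analytic b hb).eventually_analyticAt] with w hw hw'
  rw [← hw]
  exact hw'.differentiableAt.hasDerivAt

end IsContinuationOn

end Continuation

/-! ### Simple loops and trivial monodromy at a regular point -/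

lemma circleLoop_dist (c p : ℂ) (s : I) : dist (circleLoop c p s) c = dist p c := by
  have : ‖Complex.exp (2 * Real.pi * Complex.I * ((s : ℝ) : ℂ))‖ = 1 := by
    rw [Complex.norm_exp]; simp
  change dist (c + (p - c) * Complex.exp (2 * Real.pi * Complex.I * ((s : ℝ) : ℂ))) c = _
  simp [dist_eq_norm, this]

lemma IsCycle.notMem {S : Set ℂ} {o : ℂ} {i : OnePoint ℂ} {α : Path o o} (h : IsCycle S i α)
    (s : I) : α s ∉ S := by
  obtain ⟨p, τ, -, hτ, h⟩ := h
  have key : ∀ ω : Path p p, (∀ s, ω s ∉ S) → ∀ s, ((τ.trans ω).trans τ.symm) s ∉ S := by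
    intro ω hω s hs
    have : ((τ.trans ω).trans τ.symm) s ∈ range ((τ.trans ω).trans τ.symm) := mem_range_self s
    rw [Path.trans_range, Path.trans_range, Path.symm_range] at this
    obtain (⟨x, hx⟩ | ⟨x, hx⟩) | ⟨x, hx⟩ := this
    · exact hτ x (hx ▸ hs)
    · exact hω x (hx ▸ hs)
    · exact hτ x (hx ▸ hs)
  rcases h with ⟨c, -, hpc, hS, rfl⟩ | ⟨-, hS, rfl⟩
  · refine key _ (fun s hs => ?_) s
    have h1 : circleLoop c p s ∈ ({c} : Set ℂ) := by
      rw [← hS]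
      exact ⟨(circleLoop_dist c p s).le, hs⟩
    have h2 := circleLoop_dist c p s
    rw [mem_singleton_iff.1 h1, dist_self] at h2
    exact hpc (dist_eq_zero.1 h2.symm)
  · refine key _ (fun s hs => ?_) s
    have h1 : dist (circleLoop 0 p (σ s)) 0 < dist p 0 := hS hs
    rw [circleLoop_dist] at h1
    exact lt_irrefl _ h1

section Monodromy

variable {E : Type*} [NormedAddCommGroup E] [NormedSpace ℂ E] [CompleteSpace E]

/-- The solutions of a linear system which is holomorphic at `z` have trivial monodromy along a
simple loop around `z`. -/
theorem IsCycle.eventuallyEq_of_holomorphic {S : Set ℂ} (hS : IsClosed S) {z o : ℂ} (hz : z ∉ S)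
    {α : Path o o} (hα : IsCycle (insert z S) (z : OnePoint ℂ) α) {A : ℂ → E →L[ℂ] E}
    (hA : DifferentiableOn ℂ A Sᶜ) {f : ℝ → ℂ → E}
    (hf : IsContinuationOn α.extend f (Icc 0 1))
    (hode : ∀ s ∈ Icc (0 : ℝ) 1, ∀ᶠ w in 𝓝 (α.extend s), HasDerivAt (f s) (A w (f s w)) w) :
    f 0 =ᶠ[𝓝 o] f 1 := by
  obtain ⟨p, τ, -, hτ, h⟩ := hα
  rcases h with ⟨c, hc, hpc, hball, rfl⟩ | ⟨h, -⟩
  swap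
  · exact absurd h (OnePoint.coe_ne_infty z)
  obtain rfl : z = c := OnePoint.coe_injective hc
  set α := (τ.trans (circleLoop z p)).trans τ.symm with hαdef
  have hsub : Metric.closedBall z (dist p z) ⊆ Sᶜ := by
    intro w hw hwS
    have : w ∈ ({z} : Set ℂ) := hball ▸ ⟨hw, Or.inr hwS⟩
    exact hz (mem_singleton_iff.1 this ▸ hwS)
  -- The circle is the boundary of the disc through `p`, so a slightly larger disc avoiding `S` is
  -- needed for a solution holomorphic around the whole circle.
  obtain ⟨δ, hδ, hδS⟩ := (isCompact_closedBall z (dist p z)).exists_cthickening_subset_open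
    hS.isOpen_compl hsub
  rw [cthickening_closedBall hδ.le dist_nonneg] at hδS
  set R := δ + dist p z
  have hAc : ContinuousOn A (Metric.closedBall z R) := hA.continuousOn.mono hδS
  obtain ⟨M, hM⟩ := (isCompact_closedBall z R).exists_bound_of_continuousOn hAc
  have hballsub : Metric.ball z R ⊆ Sᶜ := Metric.ball_subset_closedBall.trans hδS
  have hpR : p ∈ Metric.ball z R := by
    simp only [Metric.mem_ball, R]; linarith
  obtain ⟨F, hFp, hF⟩ := exists_hasDerivAt_linear (hA.mono hballsub)
    (fun w hw => hM w (Metric.ball_subset_closedBall hw)) hpR (f (1 / 4) p)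
  have hFa : ∀ w ∈ Metric.ball z R, AnalyticAt ℂ F w := fun w hw =>
    DifferentiableOn.analyticAt
      (fun x hx => (hF x hx).differentiableAt.differentiableWithinAt)
      (Metric.isOpen_ball.mem_nhds hw)
  -- In the parametrization of the nested concatenation, `τ` occupies `[0, 1/4]`, the circle `[1/4,
  -- 1/2]` and the way back `[1/2, 1]`.
  have e1 : ∀ x ∈ Icc (0 : ℝ) 1, α.extend (x / 4) = τ.extend x := by
    intro x hx
    rw [hαdef, Path.extend_trans_of_le_half _ _ (by linarith [hx.2]),
      Path.extend_trans_of_le_half _ _ (by linarith [hx.2])]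
    congr 1; ring
  have e2 : ∀ x ∈ Icc (0 : ℝ) 1, α.extend ((x + 1) / 4) = (circleLoop z p).extend x := by
    intro x hx
    rw [hαdef, Path.extend_trans_of_le_half _ _ (by linarith [hx.2]),
      Path.extend_trans_of_half_le _ _ (by linarith [hx.1])]
    congr 1; ring
  have e3 : ∀ x ∈ Icc (0 : ℝ) 1, α.extend (1 - x / 2) = τ.extend x := by
    intro x hx
    rw [hαdef, Path.extend_trans_of_half_le _ _ (by linarith [hx.2]), Path.extend_symm_apply]
    congr 1; ring
  have h0 : (0 : ℝ) ∈ Icc (0 : ℝ) 1 := by norm_num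
  have h1 : (1 : ℝ) ∈ Icc (0 : ℝ) 1 := by norm_num
  have hpre : IsPreconnected (Icc (0 : ℝ) 1) := isPreconnected_Icc
  -- along the circle the continuation is given by `F`
  have hcirc : ∀ x ∈ Icc (0 : ℝ) 1, (circleLoop z p).extend x ∈ Metric.ball z R := by
    intro x hx
    rw [Path.extend_apply _ hx, Metric.mem_ball, circleLoop_dist]
    simp only [R]; linarith
  have c1 : IsContinuationOn (circleLoop z p).extend (f ∘ fun x => (x + 1) / 4) (Icc 0 1) :=
    hf.comp (by fun_prop) (fun x hx => ⟨by linarith [hx.1], by linarith [hx.2]⟩)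
      (fun x hx => (e2 x hx).symm)
  have c2 : IsContinuationOn (circleLoop z p).extend (fun _ => F) (Icc 0 1) :=
    IsContinuationOn.const (circleLoop z p).continuous_extend.continuousOn
      fun x hx => hFa _ (hcirc x hx)
  have q1 : α.extend (1 / 4) = p := by
    have := e2 0 h0
    simpa using this
  have q2 : α.extend (1 / 2) = p := by
    have := e2 1 h1
    rwa [Path.extend_one, show ((1 : ℝ) + 1) / 4 = 1 / 2 by norm_num] at this
  have hstart : f (1 / 4) =ᶠ[𝓝 p] F := by
    have hd := hode (1 / 4) (by norm_num)
    rw [q1] at hd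
    obtain ⟨r, hr, hrd⟩ := Metric.eventually_nhds_iff_ball.1
      (hd.and (Metric.isOpen_ball.mem_nhds hpR))
    have := eqOn_of_hasDerivAt_linear (convex_ball p r)
      (hAc.mono fun w hw => Metric.ball_subset_closedBall (hrd w hw).2)
      (fun w hw => (hrd w hw).1) (fun w hw => hF w (hrd w hw).2) (Metric.mem_ball_self hr) hFp.symm
    exact this.eventuallyEq_of_mem (Metric.ball_mem_nhds p hr)
  have hreach : f (1 / 2) =ᶠ[𝓝 p] F := by
    have := (c1.eventuallyEq_iff c2 hpre h0 h1).1
    norm_num [Function.comp_def] at this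
    simpa using this (by simpa using hstart)
  -- compare both ways along `τ`
  have d1 : IsContinuationOn τ.extend (f ∘ fun x => x / 4) (Icc 0 1) :=
    hf.comp (by fun_prop) (fun x hx => ⟨by linarith [hx.1], by linarith [hx.2]⟩)
      (fun x hx => (e1 x hx).symm)
  have d2 : IsContinuationOn τ.extend (f ∘ fun x => 1 - x / 2) (Icc 0 1) :=
    hf.comp (by fun_prop) (fun x hx => ⟨by linarith [hx.2], by linarith [hx.1]⟩)
      (fun x hx => (e3 x hx).symm)
  have := (d1.eventuallyEq_iff d2 hpre h1 h0).1
  norm_num [Function.comp_def] at this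
  exact this (by simpa using hstart.trans hreach.symm)

end Monodromy

/-! ### Piecewise smooth paths -/

section Paths

/-- On `[0, 1]` and off a countable set, the path is differentiable with bounded derivative. -/
def IsPiecewiseSmooth (γ : ℝ → ℂ) : Prop :=
  ∃ S : Set ℝ, S.Countable ∧ ∃ C : ℝ, ∀ s ∈ Icc (0 : ℝ) 1 \ S,
    DifferentiableAt ℝ γ s ∧ ‖deriv γ s‖ ≤ C

lemma isPiecewiseSmooth_of_contDiffOn {γ : ℝ → ℂ}
    (h : ContDiffOn ℝ 1 γ (Icc 0 1)) : IsPiecewiseSmooth γ := by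
  obtain ⟨C, hC⟩ := isCompact_Icc.exists_bound_of_continuousOn
    (h.continuousOn_derivWithin (uniqueDiffOn_Icc zero_lt_one) le_rfl)
  -- Smoothness is known only within `[0, 1]`, so the two-sided derivative may fail to exist at the
  -- endpoints.
  refine ⟨{0, 1}, (countable_singleton _).insert _, C, fun s hs => ?_⟩
  have hs' : Icc (0 : ℝ) 1 ∈ 𝓝 s := by
    have h2 := hs.2
    simp only [mem_insert_iff, mem_singleton_iff, not_or] at h2
    exact Icc_mem_nhds (lt_of_le_of_ne hs.1.1 (Ne.symm h2.1)) (lt_of_le_of_ne hs.1.2 h2.2)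
  refine ⟨((h.differentiableOn one_ne_zero) s hs.1).differentiableAt hs', ?_⟩
  rw [← derivWithin_of_mem_nhds hs']
  exact hC s hs.1

lemma IsPiecewiseSmooth.symm {x y : ℂ} {α : Path x y} (h : IsPiecewiseSmooth α.extend) :
    IsPiecewiseSmooth α.symm.extend := by
  obtain ⟨S, hS, C, hC⟩ := h
  refine ⟨(fun s => 1 - s) ⁻¹' S, hS.preimage_of_injOn (sub_right_injective.injOn), C,
    fun s hs => ?_⟩
  have h1 := hC (1 - s) ⟨⟨by linarith [hs.1.2], by linarith [hs.1.1]⟩, hs.2⟩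
  rw [Path.extend_symm]
  have h2 := h1.1.hasDerivAt.scomp s ((hasDerivAt_id s).const_sub 1)
  refine ⟨h2.differentiableAt, ?_⟩
  have h3 := h2.deriv
  simp only [Function.comp_def] at h3
  rw [h3]
  simpa using h1.2

lemma IsPiecewiseSmooth.trans {x y z : ℂ} {α : Path x y} {β : Path y z}
    (hα : IsPiecewiseSmooth α.extend) (hβ : IsPiecewiseSmooth β.extend) : IsPiecewiseSmooth (α.trans β).extend := by
  obtain ⟨S, hS, C, hC⟩ := hα
  obtain ⟨S', hS', C', hC'⟩ := hβ
  have i1 : Function.Injective fun s : ℝ => 2 * s := mul_right_injective₀ two_ne_zero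
  have i2 : Function.Injective fun s : ℝ => 2 * s - 1 := fun a b h => by
    simp only at h; linarith
  refine ⟨{1 / 2} ∪ ((fun s => 2 * s) ⁻¹' S ∪ (fun s => 2 * s - 1) ⁻¹' S'),
    (countable_singleton _).union ((hS.preimage_of_injOn i1.injOn).union
      (hS'.preimage_of_injOn i2.injOn)), 2 * max C C', fun s hs => ?_⟩
  obtain ⟨hs1, hs2⟩ := hs
  simp only [mem_union, mem_singleton_iff, mem_preimage, not_or] at hs2
  rcases lt_or_gt_of_ne hs2.1 with hlt | hgt
  · have h1 := hC (2 * s) ⟨⟨by linarith [hs1.1], by linarith⟩, hs2.2.1⟩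
    have h2 := h1.1.hasDerivAt.scomp s ((hasDerivAt_id s).const_mul 2)
    have h3 : (α.trans β).extend =ᶠ[𝓝 s] α.extend ∘ fun s => 2 * s := by
      filter_upwards [Iio_mem_nhds hlt] with x hx
      exact Path.extend_trans_of_le_half _ _ (le_of_lt hx)
    have h4 := HasDerivAt.congr_of_eventuallyEq h2 h3
    refine ⟨h4.differentiableAt, ?_⟩
    rw [h4.deriv, norm_smul]
    simp only [mul_one, Real.norm_eq_abs, abs_two]
    gcongr
    exact h1.2.trans (le_max_left _ _)
  · have h1 := hC' (2 * s - 1) ⟨⟨by linarith, by linarith [hs1.2]⟩, hs2.2.2⟩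
    have h2 := h1.1.hasDerivAt.scomp s (((hasDerivAt_id s).const_mul 2).sub_const 1)
    have h3 : (α.trans β).extend =ᶠ[𝓝 s] β.extend ∘ fun s => 2 * s - 1 := by
      filter_upwards [Ioi_mem_nhds hgt] with x hx
      exact Path.extend_trans_of_half_le _ _ (le_of_lt hx)
    have h4 := HasDerivAt.congr_of_eventuallyEq h2 h3
    refine ⟨h4.differentiableAt, ?_⟩
    rw [h4.deriv, norm_smul]
    simp only [mul_one, Real.norm_eq_abs, abs_two]
    gcongr
    exact h1.2.trans (le_max_right _ _)

lemma isPiecewiseSmooth_circleLoop (c p : ℂ) : IsPiecewiseSmooth (circleLoop c p).extend := by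
  apply isPiecewiseSmooth_of_contDiffOn
  have h : ContDiff ℝ 1 fun s : ℝ =>
      c + (p - c) * Complex.exp (2 * Real.pi * Complex.I * (s : ℂ)) := by
    have : ContDiff ℝ 1 fun s : ℝ => (s : ℂ) := Complex.ofRealCLM.contDiff
    fun_prop
  exact h.contDiffOn.congr fun s hs => Path.extend_apply _ hs

lemma IsCycle.isPiecewiseSmooth {S : Set ℂ} {o : ℂ} {i : OnePoint ℂ} {α : Path o o}
    (h : IsCycle S i α) : IsPiecewiseSmooth α.extend := by
  obtain ⟨p, τ, hτ, -, h⟩ := h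
  have h1 := isPiecewiseSmooth_of_contDiffOn hτ
  rcases h with ⟨c, -, -, -, rfl⟩ | ⟨-, -, rfl⟩
  · exact (h1.trans (isPiecewiseSmooth_circleLoop c p)).trans h1.symm
  · exact (h1.trans (isPiecewiseSmooth_circleLoop 0 p).symm).trans h1.symm

lemma IsPiecewiseSmooth.pochhammer {o : ℂ} {α β : Path o o} (hα : IsPiecewiseSmooth α.extend)
    (hβ : IsPiecewiseSmooth β.extend) : IsPiecewiseSmooth (pochhammer α β).extend :=
  (hα.symm.trans hβ.symm).trans (hα.trans hβ)

/-- A function of a real variable takes a given value with nonzero derivative only countably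
often. -/
lemma countable_eq_and_deriv_ne_zero {E : Type*} [NormedAddCommGroup E] [NormedSpace ℝ E]
    (g : ℝ → E) (c : E) : {s | g s = c ∧ deriv g s ≠ 0}.Countable := by
  -- A nonzero derivative keeps `g` away from `c` at nearby points, so each point of the set is
  -- isolated in it from the right, and only countably many points can be.
  refine (countable_setOfPred_isolated_right_within (s := {s | g s = c ∧ deriv g s ≠ 0})).mono ?_
  intro s hs
  refine ⟨hs, ?_⟩
  have hd : HasDerivAt g (deriv g s) s := (differentiableAt_of_deriv_ne_zero hs.2).hasDerivAt
  rw [← eventually_false_iff_eq_bot]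
  have h1 : ∀ᶠ x in 𝓝[{s | g s = c ∧ deriv g s ≠ 0} ∩ Ioi s] s, g x ≠ c :=
    (hd.eventually_ne hs.2).filter_mono (nhdsWithin_mono s fun x hx => ne_of_gt hx.2)
  filter_upwards [h1, eventually_mem_nhdsWithin] with x hx hx'
  exact hx hx'.1.1

end Paths

/-! ### The Pochhammer contour -/

section Pochhammer

variable {o : ℂ} (α β : Path o o)

lemma pochhammer_extend_first {s : ℝ} (hs : s ∈ Icc (0 : ℝ) 1) :
    (pochhammer α β).extend (s / 4) = α.extend (1 - s) := by
  rw [pochhammer, Path.extend_trans_of_le_half _ _ (by linarith [hs.2]),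
    Path.extend_trans_of_le_half _ _ (by linarith [hs.2]), Path.extend_symm_apply]
  congr 1; ring

lemma pochhammer_extend_second {s : ℝ} (hs : s ∈ Icc (0 : ℝ) 1) :
    (pochhammer α β).extend ((1 + s) / 4) = β.extend (1 - s) := by
  rw [pochhammer, Path.extend_trans_of_le_half _ _ (by linarith [hs.2]),
    Path.extend_trans_of_half_le _ _ (by linarith [hs.1]), Path.extend_symm_apply]
  congr 1; ring

lemma pochhammer_extend_third {s : ℝ} (hs : s ∈ Icc (0 : ℝ) 1) :
    (pochhammer α β).extend ((2 + s) / 4) = α.extend s := by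
  rw [pochhammer, Path.extend_trans_of_half_le _ _ (by linarith [hs.1]),
    Path.extend_trans_of_le_half _ _ (by linarith [hs.2])]
  congr 1; ring

lemma pochhammer_extend_fourth {s : ℝ} (hs : s ∈ Icc (0 : ℝ) 1) :
    (pochhammer α β).extend ((3 + s) / 4) = β.extend s := by
  rw [pochhammer, Path.extend_trans_of_half_le _ _ (by linarith [hs.1]),
    Path.extend_trans_of_half_le _ _ (by linarith [hs.1])]
  congr 1; ring

variable {α β}

/-- If continuation along `α` is trivial, then so is continuation along `[α, β]`. -/
theorem IsContinuationOn.pochhammer_eventuallyEq {E : Type*} [NormedAddCommGroup E]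
    [NormedSpace ℂ E] [CompleteSpace E] {f : ℝ → ℂ → E}
    (hf : IsContinuationOn (pochhammer α β).extend f (Icc 0 1))
    (h₁ : f (1 / 4) =ᶠ[𝓝 o] f 0) (h₂ : f (1 / 2) =ᶠ[𝓝 o] f (3 / 4)) : f 1 =ᶠ[𝓝 o] f 0 := by
  -- The second quarter read backwards and the last quarter are two continuations along `β`. They
  -- start at parameters `1/2` and `3/4` and end at `1/4` and `1`.
  have d1 : IsContinuationOn β.extend (f ∘ fun x => (1 + (1 - x)) / 4) (Icc 0 1) :=
    hf.comp (by fun_prop) (fun x hx => ⟨by linarith [hx.2], by linarith [hx.1]⟩) fun x hx => by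
      simp only [Function.comp]
      rw [pochhammer_extend_second α β ⟨by linarith [hx.2], by linarith [hx.1]⟩]
      congr 1; ring
  have d2 : IsContinuationOn β.extend (f ∘ fun x => (3 + x) / 4) (Icc 0 1) :=
    hf.comp (by fun_prop) (fun x hx => ⟨by linarith [hx.1], by linarith [hx.2]⟩) fun x hx => by
      simp only [Function.comp]
      rw [pochhammer_extend_fourth α β hx]
  have := (d1.eventuallyEq_iff d2 isPreconnected_Icc (left_mem_Icc.2 zero_le_one)
    (right_mem_Icc.2 zero_le_one)).1
  norm_num [Function.comp_def] at this
  norm_num at h₁ h₂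
  exact (this h₂).symm.trans h₁

/-- A logarithm of a nonvanishing function returns to its initial value along `[α, β]`. -/
theorem pochhammer_log_eq {ℓ : ℝ → ℂ} (hℓ : ContinuousOn ℓ (Icc 0 1)) {z : ℂ}
    (hexp : ∀ s ∈ Icc (0 : ℝ) 1, Complex.exp (ℓ s) = z - (pochhammer α β).extend s) :
    ℓ 1 = ℓ 0 := by
  -- Two logarithms of the same function along the same curve differ by a continuous function with
  -- values in `2πi ℤ`, hence by a constant. This is applied to the two passages along `α`, then to
  -- those along `β`.
  have key : ∀ φ ψ : ℝ → ℝ, Continuous φ → Continuous ψ → MapsTo φ (Icc 0 1) (Icc 0 1) →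
      MapsTo ψ (Icc 0 1) (Icc 0 1) → (∀ s ∈ Icc (0 : ℝ) 1,
        (pochhammer α β).extend (φ s) = (pochhammer α β).extend (ψ s)) →
      ℓ (φ 0) - ℓ (ψ 0) = ℓ (φ 1) - ℓ (ψ 1) := by
    intro φ ψ hφ hψ hφm hψm h
    have hc : ContinuousOn (fun s => (ℓ (φ s) - ℓ (ψ s)) / (2 * Real.pi * Complex.I)) (Icc 0 1) :=
      ((hℓ.comp hφ.continuousOn hφm).sub (hℓ.comp hψ.continuousOn hψm)).div_const _
    have hZ : ∀ s ∈ Icc (0 : ℝ) 1, (ℓ (φ s) - ℓ (ψ s)) / (2 * Real.pi * Complex.I) ∈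
        range ((↑) : ℤ → ℂ) := by
      intro s hs
      have h1 : Complex.exp (ℓ (φ s)) = Complex.exp (ℓ (ψ s)) := by
        rw [hexp _ (hφm hs), hexp _ (hψm hs), h s hs]
      obtain ⟨n, hn⟩ := Complex.exp_eq_exp_iff_exists_int.1 h1
      refine ⟨n, ?_⟩
      rw [hn, add_sub_cancel_left, mul_div_cancel_right₀ _ Complex.two_pi_I_ne_zero]
    have := isPreconnected_Icc.constant_of_mapsTo
      Complex.isClosedEmbedding_intCast.isInducing.isDiscrete_range hc hZ (left_mem_Icc.2 zero_le_one) (right_mem_Icc.2 zero_le_one)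
    simpa [div_left_inj' Complex.two_pi_I_ne_zero] using this
  have h1 := key (fun s => s / 4) (fun s => (2 + (1 - s)) / 4) (by fun_prop) (by fun_prop)
    (fun x hx => ⟨by linarith [hx.1], by linarith [hx.2]⟩)
    (fun x hx => ⟨by linarith [hx.2], by linarith [hx.1]⟩) fun s hs => by
      rw [pochhammer_extend_first α β hs,
        pochhammer_extend_third α β ⟨by linarith [hs.2], by linarith [hs.1]⟩]
  have h2 := key (fun s => (1 + s) / 4) (fun s => (3 + (1 - s)) / 4) (by fun_prop) (by fun_prop)
    (fun x hx => ⟨by linarith [hx.1], by linarith [hx.2]⟩)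
    (fun x hx => ⟨by linarith [hx.2], by linarith [hx.1]⟩) fun s hs => by
      rw [pochhammer_extend_second α β hs,
        pochhammer_extend_fourth α β ⟨by linarith [hs.2], by linarith [hs.1]⟩]
  norm_num at h1 h2
  linear_combination -h1 - h2

end Pochhammer

/-! ### Path integrals and local primitives -/

section Deformation

variable {E : Type*} [NormedAddCommGroup E] [NormedSpace ℂ E]

lemma IsPiecewiseSmooth.intervalIntegrable {γ : ℝ → ℂ} (hγ : IsPiecewiseSmooth γ) {φ : ℝ → E}
    (hφ : ContinuousOn φ (Icc 0 1)) :
    IntervalIntegrable (fun s => deriv γ s • φ s) MeasureTheory.volume 0 1 := by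
  obtain ⟨S, hS, C, hC⟩ := hγ
  obtain ⟨M, hM⟩ := isCompact_Icc.exists_bound_of_continuousOn hφ
  rw [intervalIntegrable_iff_integrableOn_Icc_of_le zero_le_one]
  refine MeasureTheory.IntegrableOn.of_bound (C := C * M) (by simp)
    ((measurable_deriv γ).aestronglyMeasurable.smul
      (hφ.aestronglyMeasurable measurableSet_Icc)) ?_
  rw [MeasureTheory.ae_restrict_iff' measurableSet_Icc]
  filter_upwards [hS.ae_notMem MeasureTheory.volume] with s hs hs'
  rw [norm_smul]
  have := (hC s ⟨hs', hs⟩).2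
  have h2 := hM s hs'
  gcongr
  exact (norm_nonneg _).trans this

lemma uIcc_subset_Icc_zero_one {a b : ℝ} (ha : a ∈ Icc (0 : ℝ) 1) (hb : b ∈ Icc (0 : ℝ) 1) :
    uIcc a b ⊆ Icc 0 1 := ordConnected_Icc.uIcc_subset ha hb

/-- The integral along a path of a function with a primitive. -/
lemma IsPiecewiseSmooth.integral_eq_sub [CompleteSpace E] {γ : ℝ → ℂ} (hγ : IsPiecewiseSmooth γ)
    (hγc : ContinuousOn γ (Icc 0 1)) {K : ℂ → E} {φ : ℝ → E} (hφ : ContinuousOn φ (Icc 0 1))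
    {a b : ℝ} (ha : a ∈ Icc (0 : ℝ) 1) (hb : b ∈ Icc (0 : ℝ) 1)
    (hK : ∀ s ∈ uIcc a b, HasDerivAt K (φ s) (γ s)) :
    ∫ s in a..b, deriv γ s • φ s = K (γ b) - K (γ a) := by
  have hsub := uIcc_subset_Icc_zero_one ha hb
  have hint : IntervalIntegrable (fun s => deriv γ s • φ s) MeasureTheory.volume a b :=
    (hγ.intervalIntegrable hφ).mono_set (by rwa [uIcc_of_le (zero_le_one' ℝ)])
  obtain ⟨S, hS, C, hC⟩ := hγ
  refine MeasureTheory.integral_eq_of_hasDerivAt_off_countable (fun s => K (γ s)) _ hS ?_ ?_ hint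
  · intro s hs
    exact (hK s hs).continuousAt.comp_continuousWithinAt ((hγc.mono hsub) s hs)
  · intro s hs
    have hs' : s ∈ uIcc a b := Ioo_subset_Icc_self hs.1
    exact (hK s hs').scomp s (hC s ⟨hsub hs', hs.2⟩).1.hasDerivAt

variable [CompleteSpace E]

/-- Writes a primitive as an integral over `[0, 1]`, a form in which it can be differentiated with
respect to a parameter. -/
lemma eq_integral_segment {K h : ℂ → E} {c : ℂ} {r : ℝ} (hr : 0 < r)
    (hK : ∀ w ∈ Metric.ball c r, HasDerivAt K (h w) w) (hh : ContinuousOn h (Metric.ball c r))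
    {w : ℂ} (hw : w ∈ Metric.ball c r) :
    K w - K c = ∫ x in (0 : ℝ)..1, (w - c) • h (c + x * (w - c)) := by
  have hd : ∀ s : ℝ, HasDerivAt (fun s : ℝ => c + (s : ℂ) * (w - c)) (w - c) s := by
    intro s
    simpa using ((Complex.ofRealCLM.hasDerivAt (x := s)).mul_const (w - c)).const_add c
  have hV : ∀ s ∈ Icc (0 : ℝ) 1, c + (s : ℂ) * (w - c) ∈ Metric.ball c r := by
    intro s hs
    have := (convex_ball c r).add_smul_sub_mem (Metric.mem_ball_self hr) hw hs
    simpa only [Complex.real_smul] using this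
  have h01 : uIcc (0 : ℝ) 1 = Icc 0 1 := uIcc_of_le zero_le_one
  rw [intervalIntegral.integral_eq_sub_of_hasDerivAt
    (f := fun s : ℝ => K (c + (s : ℂ) * (w - c)))]
  · simp
  · intro s hs
    rw [h01] at hs
    exact (hK _ (hV s hs)).scomp s (hd s)
  · refine ContinuousOn.intervalIntegrable ?_
    rw [h01]
    refine ContinuousOn.const_smul (hh.comp (by fun_prop) hV) (w - c)

/-- Local primitives of a function of two variables, differentiated in the parameter. -/
lemma exists_local_primitive {H : ℂ × ℂ → E} {z₀ c : ℂ} (hH : AnalyticAt ℂ H (z₀, c)) :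
    ∃ r > 0, ∃ (K : ℂ → ℂ → E) (k : ℂ → E),
      (∀ z ∈ Metric.ball z₀ r, ∀ w ∈ Metric.ball c r, AnalyticAt ℂ H (z, w)) ∧
      (∀ z ∈ Metric.ball z₀ r, ∀ w ∈ Metric.ball c r, HasDerivAt (K z) (H (z, w)) w) ∧
      ∀ w ∈ Metric.ball c r, HasDerivAt (fun z => K z w) (k w) z₀ ∧
        HasDerivAt k (fderiv ℂ H (z₀, w) (1, 0)) w := by
  have hM := hH.fderiv.continuousAt.norm.eventually_lt
    (continuousAt_const (y := ‖fderiv ℂ H (z₀, c)‖ + 1)) (lt_add_one _)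
  obtain ⟨r, hr, hrM⟩ := Metric.eventually_nhds_iff_ball.1
    (hH.eventually_analyticAt.and hM)
  rw [← ball_prod_same] at hrM
  set M' := ‖fderiv ℂ H (z₀, c)‖ + 1
  have hHa : ∀ z ∈ Metric.ball z₀ r, ∀ w ∈ Metric.ball c r, AnalyticAt ℂ H (z, w) :=
    fun z hz w hw => (hrM (z, w) ⟨hz, hw⟩).1
  have hdw : ∀ z ∈ Metric.ball z₀ r, DifferentiableOn ℂ (fun w => H (z, w)) (Metric.ball c r) :=
    fun z hz w hw => ((hHa z hz w hw).differentiableAt.comp w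
      (by fun_prop : DifferentiableAt ℂ (fun w => (z, w)) w)).differentiableWithinAt
  have hz₀ : z₀ ∈ Metric.ball z₀ r := Metric.mem_ball_self hr
  have hDd : DifferentiableOn ℂ (fun w => fderiv ℂ H (z₀, w) (1, 0)) (Metric.ball c r) :=
    fun w hw => (((hHa z₀ hz₀ w hw).fderiv.differentiableAt.comp w
      (by fun_prop : DifferentiableAt ℂ (fun w => (z₀, w)) w)).clm_apply
      (differentiableAt_const _)).differentiableWithinAt
  have hKex : ∀ z, ∃ K : ℂ → E, z ∈ Metric.ball z₀ r →
      K c = 0 ∧ ∀ w ∈ Metric.ball c r, HasDerivAt K (H (z, w)) w := by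
    intro z
    by_cases hz : z ∈ Metric.ball z₀ r
    · obtain ⟨K, h⟩ := (hdw z hz).isExactOn_ball.with_val_at c 0
      exact ⟨K, fun _ => h⟩
    · exact ⟨0, fun h => absurd h hz⟩
  choose K hK using hKex
  obtain ⟨k, hk0, hk⟩ := hDd.isExactOn_ball.with_val_at c 0
  refine ⟨r, hr, K, k, hHa, fun z hz => (hK z hz).2, fun w hw => ⟨?_, hk w hw⟩⟩
  have hV : ∀ s ∈ Icc (0 : ℝ) 1, c + (s : ℂ) * (w - c) ∈ Metric.ball c r := by
    intro s hs
    have := (convex_ball c r).add_smul_sub_mem (Metric.mem_ball_self hr) hw hs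
    simpa only [Complex.real_smul] using this
  -- The primitives `K z` and `k` are normalized to vanish at `c`, so both are integrals over the
  -- same segment, and differentiation under the integral sign identifies `k` with the
  -- `z`-derivative of `K` at `z₀`.
  have e1 : ∀ z ∈ Metric.ball z₀ r,
      K z w = ∫ x in (0 : ℝ)..1, (w - c) • H (z, c + x * (w - c)) := by
    intro z hz
    have := eq_integral_segment hr (hK z hz).2 (hdw z hz).continuousOn hw
    rwa [(hK z hz).1, sub_zero] at this
  have e2 : k w = ∫ x in (0 : ℝ)..1, (w - c) • fderiv ℂ H (z₀, c + x * (w - c)) (1, 0) := by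
    have := eq_integral_segment hr hk hDd.continuousOn hw
    rwa [hk0, sub_zero] at this
  have hcont : ∀ z ∈ Metric.ball z₀ r,
      ContinuousOn (fun x : ℝ => (w - c) • H (z, c + x * (w - c))) (Icc 0 1) := fun z hz =>
    ((hdw z hz).continuousOn.comp (by fun_prop) hV).const_smul (w - c)
  have h01 : uIcc (0 : ℝ) 1 = Icc 0 1 := uIcc_of_le zero_le_one
  have hI : uIoc (0 : ℝ) 1 ⊆ Icc 0 1 := by
    rw [uIoc_of_le zero_le_one]; exact Ioc_subset_Icc_self
  have main := (intervalIntegral.hasDerivAt_integral_of_dominated_loc_of_deriv_le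
    (μ := MeasureTheory.volume) (a := (0 : ℝ)) (b := 1)
    (F := fun z (x : ℝ) => (w - c) • H (z, c + x * (w - c)))
    (F' := fun z (x : ℝ) => (w - c) • fderiv ℂ H (z, c + x * (w - c)) (1, 0))
    (bound := fun _ => ‖w - c‖ * (M' * ‖((1 : ℂ), (0 : ℂ))‖))
    (Metric.ball_mem_nhds z₀ hr) ?_ ?_ ?_ ?_ ?_ ?_).2
  · rw [e2]
    refine main.congr_of_eventuallyEq ?_
    filter_upwards [Metric.ball_mem_nhds z₀ hr] with z hz using e1 z hz
  · filter_upwards [Metric.ball_mem_nhds z₀ hr] with z hz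
    exact ((hcont z hz).mono hI).aestronglyMeasurable measurableSet_uIoc
  · exact ContinuousOn.intervalIntegrable (by rw [h01]; exact hcont z₀ hz₀)
  · refine ContinuousOn.aestronglyMeasurable ?_ measurableSet_uIoc
    refine ContinuousOn.mono (ContinuousOn.const_smul ?_ (w - c)) hI
    exact hDd.continuousOn.comp (by fun_prop) hV
  · refine Eventually.of_forall fun x hx z hz => ?_
    rw [norm_smul]
    gcongr
    exact (fderiv ℂ H _).le_of_opNorm_le (hrM (z, _) ⟨hz, hV x (hI hx)⟩).2.le _
  · exact intervalIntegrable_const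
  · refine Eventually.of_forall fun x hx z hz => ?_
    have h1 := (hHa z hz _ (hV x (hI hx))).differentiableAt.hasFDerivAt
    have h2 : HasDerivAt (fun z : ℂ => (z, c + (x : ℂ) * (w - c))) ((1 : ℂ), (0 : ℂ)) z :=
      (hasDerivAt_id z).prodMk (hasDerivAt_const z _)
    exact (h1.comp_hasDerivAt z h2).const_smul (w - c)

end Deformation

/-! ### Differentiating an integral over a moving path -/

section Deformation

variable {E : Type*} [NormedAddCommGroup E] [NormedSpace ℂ E]

/-- Two primitives of the same function near `(z₀, c)` differ by a function of the parameter. -/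
lemma eventually_sub_eq_of_hasDerivAt {K L : ℂ → ℂ → E} {H : ℂ × ℂ → E} {z₀ c : ℂ}
    (hK : ∀ᶠ q in 𝓝 (z₀, c), HasDerivAt (K q.1) (H q) q.2)
    (hL : ∀ᶠ q in 𝓝 (z₀, c), HasDerivAt (L q.1) (H q) q.2) :
    ∀ᶠ q in 𝓝 (z₀, c), K q.1 q.2 - L q.1 q.2 = K q.1 c - L q.1 c := by
  obtain ⟨r, hr, h⟩ := Metric.eventually_nhds_iff_ball.1 (hK.and hL)
  filter_upwards [Metric.ball_mem_nhds (z₀, c) hr] with q hq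
  rw [← ball_prod_same] at hq h
  have hd : ∀ w ∈ Metric.ball c r, HasDerivAt (fun w => K q.1 w - L q.1 w) 0 w := by
    intro w hw
    have := h (q.1, w) ⟨hq.1, hw⟩
    exact (this.1.sub this.2).congr_deriv (sub_self _)
  refine Convex.is_const_of_fderivWithin_eq_zero (𝕜 := ℂ) (convex_ball c r)
    (f := fun w => K q.1 w - L q.1 w)
    (fun w hw => (hd w hw).differentiableAt.differentiableWithinAt) (fun w hw => ?_) hq.2
    (Metric.mem_ball_self hr)
  rw [fderivWithin_of_isOpen Metric.isOpen_ball hw]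
  have := (hd w hw).hasFDerivAt.fderiv
  simpa using this

/-- Differentiation in a parameter of the integral of a multivalued function along a path which
is deformed with the parameter, its endpoints being fixed. Near the path for the parameter `z₀`, the
function is given by the function elements `H s`. -/
theorem hasDerivAt_integral_deformation [CompleteSpace E] {z₀ o o' : ℂ} {γ : ℂ → ℝ → ℂ} {H : ℝ → ℂ × ℂ → E}
    {φ : ℂ → ℝ → E}
    (hγ : ∀ s ∈ Icc (0 : ℝ) 1, Tendsto (fun q : ℂ × ℝ => γ q.1 q.2) (𝓝 z₀ ×ˢ 𝓝[Icc 0 1] s)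
      (𝓝 (γ z₀ s)))
    (hγp : ∀ᶠ z in 𝓝 z₀, IsPiecewiseSmooth (γ z))
    (hγc : ∀ᶠ z in 𝓝 z₀, ContinuousOn (γ z) (Icc 0 1))
    (hγ0 : ∀ᶠ z in 𝓝 z₀, γ z 0 = o) (hγ1 : ∀ᶠ z in 𝓝 z₀, γ z 1 = o')
    (hφc : ∀ᶠ z in 𝓝 z₀, ContinuousOn (φ z) (Icc 0 1))
    (hH : ∀ s ∈ Icc (0 : ℝ) 1, AnalyticAt ℂ (H s) (z₀, γ z₀ s))
    (hHc : ∀ s ∈ Icc (0 : ℝ) 1, ∀ᶠ s' in 𝓝[Icc 0 1] s, H s' =ᶠ[𝓝 (z₀, γ z₀ s')] H s)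
    (hφ : ∀ s ∈ Icc (0 : ℝ) 1, ∀ᶠ q : ℂ × ℝ in 𝓝 z₀ ×ˢ 𝓝[Icc 0 1] s,
      φ q.1 q.2 = H s (q.1, γ q.1 q.2)) :
    HasDerivAt (fun z => ∫ s in (0 : ℝ)..1, deriv (γ z) s • φ z s)
      (∫ s in (0 : ℝ)..1, deriv (γ z₀) s • fderiv ℂ (H s) (z₀, γ z₀ s) (1, 0)) z₀ := by
  set D : ℝ → E := fun s => fderiv ℂ (H s) (z₀, γ z₀ s) (1, 0) with hD
  have hγ₀c : ContinuousOn (γ z₀) (Icc 0 1) := hγc.self_of_nhds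
  have hγ₀p : IsPiecewiseSmooth (γ z₀) := hγp.self_of_nhds
  have hDc : ContinuousOn D (Icc 0 1) := by
    intro s hs
    have h1 : ContinuousWithinAt (fun s' => fderiv ℂ (H s) (z₀, γ z₀ s') (1, 0)) (Icc 0 1) s := by
      have h2 : ContinuousAt (fun q => fderiv ℂ (H s) q (1, 0)) (z₀, γ z₀ s) :=
        (hH s hs).fderiv.continuousAt.clm_apply continuousAt_const
      exact ContinuousAt.comp_continuousWithinAt (f := fun s' => (z₀, γ z₀ s'))
        (g := fun q => fderiv ℂ (H s) q (1, 0)) h2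
        (continuousWithinAt_const.prodMk (hγ₀c s hs))
    refine h1.congr_of_eventuallyEq_of_mem ?_ hs
    filter_upwards [hHc s hs] with s' hs'
    simp only [hD, hs'.fderiv_eq]
  have hint : ∀ {ψ : ℝ → E} {z a b}, IsPiecewiseSmooth (γ z) → ContinuousOn ψ (Icc 0 1) →
      a ∈ Icc (0 : ℝ) 1 → b ∈ Icc (0 : ℝ) 1 →
      IntervalIntegrable (fun s => deriv (γ z) s • ψ s) MeasureTheory.volume a b := by
    intro ψ z a b hz hψ ha hb
    refine (hz.intervalIntegrable hψ).mono_set ?_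
    rw [uIcc_of_le (zero_le_one' ℝ)]
    exact uIcc_subset_Icc_zero_one ha hb
  have h0 : (0 : ℝ) ∈ Icc (0 : ℝ) 1 := left_mem_Icc.2 zero_le_one
  have h1 : (1 : ℝ) ∈ Icc (0 : ℝ) 1 := right_mem_Icc.2 zero_le_one
  -- the integral up to `s` is given near `z₀` by a primitive `K z` evaluated at `γ z s`
  let P : ℝ → Prop := fun s => ∃ (K : ℂ → ℂ → E) (k : ℂ → E),
    (∀ᶠ z in 𝓝 z₀, ∫ x in (0 : ℝ)..s, deriv (γ z) x • φ z x = K z (γ z s)) ∧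
    (∀ᶠ q in 𝓝 (z₀, γ z₀ s), HasDerivAt (K q.1) (H s q) q.2) ∧
    (∀ᶠ w in 𝓝 (γ z₀ s), HasDerivAt (fun z => K z w) (k w) z₀ ∧
      HasDerivAt k (fderiv ℂ (H s) (z₀, w) (1, 0)) w) ∧
    ∫ x in (0 : ℝ)..s, deriv (γ z₀) x • D x = k (γ z₀ s)
  have hstart : P 0 := by
    obtain ⟨r, hr, K, k, -, h2, h3⟩ := exists_local_primitive (hH 0 h0)
    refine ⟨fun z w => K z w - K z o, fun w => k w - k o, ?_, ?_, ?_, ?_⟩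
    · filter_upwards [hγ0] with z hz
      simp [hz]
    · filter_upwards [Metric.ball_mem_nhds (z₀, γ z₀ 0) hr] with q hq
      rw [← ball_prod_same] at hq
      exact (h2 q.1 hq.1 q.2 hq.2).sub_const _
    · filter_upwards [Metric.ball_mem_nhds (γ z₀ 0) hr] with w hw
      have ho : o ∈ Metric.ball (γ z₀ 0) r := by
        rw [hγ0.self_of_nhds]; exact Metric.mem_ball_self hr
      exact ⟨(h3 w hw).1.sub (h3 o ho).1, (h3 w hw).2.sub_const _⟩
    · simp [hγ0.self_of_nhds]
  have hloc : ∀ s₀ ∈ Icc (0 : ℝ) 1, ∃ δ > 0, ∀ a ∈ Icc (0 : ℝ) 1 ∩ Metric.ball s₀ δ,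
      ∀ b ∈ Icc (0 : ℝ) 1 ∩ Metric.ball s₀ δ, P a → P b := by
    intro s₀ hs₀
    obtain ⟨r, hr, K₀, k₀, hHa, hK₀, hk₀⟩ := exists_local_primitive (hH s₀ hs₀)
    obtain ⟨pa, hpa, pb, hpb, hab⟩ := eventually_prod_iff.1
      (((hγ s₀ hs₀).eventually (Metric.ball_mem_nhds _ hr)).and (hφ s₀ hs₀))
    obtain ⟨δ, hδ, hδN⟩ := Metric.mem_nhdsWithin_iff.1 (hpb.and (hHc s₀ hs₀))
    rw [inter_comm] at hδN
    refine ⟨δ, hδ, fun a ha b hb => ?_⟩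
    have hz₀ : z₀ ∈ Metric.ball z₀ r := Metric.mem_ball_self hr
    have hab01 := uIcc_subset_Icc_zero_one ha.1 hb.1
    have hN : ∀ x ∈ uIcc a b, pb x ∧ H x =ᶠ[𝓝 (z₀, γ z₀ x)] H s₀ := fun x hx =>
      hδN ⟨hab01 hx, by
        rw [Real.ball_eq_Ioo] at ha hb ⊢
        exact ordConnected_Ioo.uIcc_subset ha.2 hb.2 hx⟩
    have haN := hN a left_mem_uIcc
    have hbN := hN b right_mem_uIcc
    have hγz : ∀ x ∈ uIcc a b, γ z₀ x ∈ Metric.ball (γ z₀ s₀) r := fun x hx =>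
      (hab hpa.self_of_nhds (hN x hx).1).1
    have hK₀e : ∀ x ∈ uIcc a b, ∀ᶠ q in 𝓝 (z₀, γ z₀ x), HasDerivAt (K₀ q.1) (H x q) q.2 := by
      intro x hx
      filter_upwards [(hN x hx).2, prod_mem_nhds (Metric.ball_mem_nhds z₀ hr)
        (Metric.isOpen_ball.mem_nhds (hγz x hx))] with q hq hq'
      rw [hq]
      exact hK₀ q.1 hq'.1 q.2 hq'.2
    rintro ⟨K, k, hi, hii, hiii, hiv⟩
    -- The local primitive is shifted to continue `K`. The shift is evaluated at the fixed point `γ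
    -- z₀ a`, not at the moving point `γ z a`, which makes it differentiable in `z`; for `z` near
    -- `z₀` both points give the same shift, by `eventually_sub_eq_of_hasDerivAt`.
    refine ⟨fun z w => K z (γ z₀ a) - K₀ z (γ z₀ a) + K₀ z w,
      fun w => k (γ z₀ a) - k₀ (γ z₀ a) + k₀ w, ?_, ?_, ?_, ?_⟩
    · have hta : Tendsto (fun z => (z, γ z a)) (𝓝 z₀) (𝓝 (z₀, γ z₀ a)) := by
        refine tendsto_id.prodMk_nhds ?_
        exact (hγ a ha.1).comp (tendsto_id.prodMk
          (tendsto_const_pure.mono_right (pure_le_nhdsWithin ha.1)))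
      filter_upwards [hi, hta.eventually (eventually_sub_eq_of_hasDerivAt hii
        (hK₀e a left_mem_uIcc)), hpa, hγp, hγc, hφc, Metric.ball_mem_nhds z₀ hr]
        with z e1 e2 e3 e4 e5 e6 e7
      rw [← intervalIntegral.integral_add_adjacent_intervals (hint e4 e6 h0 ha.1)
        (hint e4 e6 ha.1 hb.1), e1, e4.integral_eq_sub e5 e6 ha.1 hb.1 (K := K₀ z), ← e2]
      · abel
      · intro x hx
        obtain ⟨f1, f2⟩ := hab e3 (hN x hx).1
        simp only at f1 f2
        rw [f2]
        exact hK₀ z e7 _ f1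
    · filter_upwards [hK₀e b right_mem_uIcc] with q hq using hq.const_add _
    · have hf : ∀ᶠ w in 𝓝 (γ z₀ b), fderiv ℂ (H b) (z₀, w) = fderiv ℂ (H s₀) (z₀, w) :=
        (Continuous.prodMk_right z₀).continuousAt.eventually hbN.2.fderiv
      have hmem : ∀ᶠ w in 𝓝 (γ z₀ b), w ∈ Metric.ball (γ z₀ s₀) r :=
        Metric.isOpen_ball.mem_nhds (hγz b right_mem_uIcc)
      filter_upwards [hf, hmem] with w hw hw'
      rw [hw]
      exact ⟨((hiii.self_of_nhds.1.sub (hk₀ _ (hγz a left_mem_uIcc)).1)).add (hk₀ w hw').1,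
        (hk₀ w hw').2.const_add _⟩
    · rw [← intervalIntegral.integral_add_adjacent_intervals (hint hγ₀p hDc h0 ha.1)
        (hint hγ₀p hDc ha.1 hb.1), hiv, hγ₀p.integral_eq_sub hγ₀c hDc ha.1 hb.1 (K := k₀)]
      · abel_nf
      · intro x hx
        have := (hk₀ _ (hγz x hx)).2
        rwa [← (hN x hx).2.fderiv_eq] at this
  have hend : P 1 := by
    refine (isPreconnected_Icc (a := (0 : ℝ)) (b := 1)).induction₂ (fun a b => P a ↔ P b) ?_
      (fun x y z _ _ _ h h' => h.trans h') (fun x y _ _ h => h.symm) h0 h1 |>.1 hstart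
    intro s hs
    obtain ⟨δ, hδ, h⟩ := hloc s hs
    filter_upwards [inter_mem_nhdsWithin (Icc (0 : ℝ) 1) (Metric.ball_mem_nhds s hδ)] with b hb
    have hs' : s ∈ Icc (0 : ℝ) 1 ∩ Metric.ball s δ := ⟨hs, Metric.mem_ball_self hδ⟩
    exact ⟨h s hs' b hb, h b hb s hs'⟩
  obtain ⟨K, k, hi, -, hiii, hiv⟩ := hend
  rw [hiv]
  -- Only here is the fixed endpoint used: the integral is `K z o'`, with no moving argument left.
  refine hiii.self_of_nhds.1.congr_of_eventuallyEq ?_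
  filter_upwards [hi, hγ1] with z hz hz'
  rw [hz, hz', hγ1.self_of_nhds]

end Deformation

/-! ### Continuation along a family of paths -/

section EulerTransform

/-- The difference is an integer multiple of `2πi` tending to zero, hence eventually zero. -/
lemma eventuallyEq_of_exp_eq {X : Type*} {l : Filter X} {a b : X → ℂ} {c : ℂ}
    (ha : Tendsto a l (𝓝 c)) (hb : Tendsto b l (𝓝 c))
    (h : ∀ᶠ x in l, Complex.exp (a x) = Complex.exp (b x)) : a =ᶠ[l] b := by
  have h1 : Tendsto (fun x => ‖a x - b x‖) l (𝓝 0) := by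
    simpa using (ha.sub hb).norm
  filter_upwards [h, h1.eventually_lt_const (zero_lt_one' ℝ)] with x hx hlt
  obtain ⟨n, hn⟩ := Complex.exp_eq_exp_iff_exists_int.1 hx
  have h2 : ‖a x - b x‖ = |(n : ℝ)| * (2 * Real.pi) := by
    rw [hn, add_sub_cancel_left]
    simp [abs_of_pos Real.pi_pos]
  rw [h2] at hlt
  have hn0 : n = 0 := by
    by_contra hne
    have h3 : (1 : ℝ) ≤ |(n : ℝ)| := by exact_mod_cast Int.one_le_abs hne
    nlinarith [Real.pi_gt_three]
  simpa [hn0] using hn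

lemma analyticAt_clm_apply {X E F : Type*} [NormedAddCommGroup X] [NormedSpace ℂ X]
    [NormedAddCommGroup E] [NormedSpace ℂ E] [NormedAddCommGroup F] [NormedSpace ℂ F]
    [CompleteSpace F] {L : X → E →L[ℂ] F} {g : X → E} {x : X} (hL : AnalyticAt ℂ L x)
    (hg : AnalyticAt ℂ g x) : AnalyticAt ℂ (fun x => L x (g x)) x :=
  ((ContinuousLinearMap.id ℂ (E →L[ℂ] F)).analyticAt_bilinear (L x, g x)).comp₂ hL hg

variable {E : Type*} [NormedAddCommGroup E] [NormedSpace ℂ E] [CompleteSpace E]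

/-- Analytic continuations along a continuous family of paths with fixed initial point have locally
the same function elements. -/
theorem eventually_continuation_eventuallyEq {z₀ o : ℂ} {γ : ℂ → ℝ → ℂ} {f : ℂ → ℝ → ℂ → E}
    {Y : ℂ → E}
    (hγ : ∀ s ∈ Icc (0 : ℝ) 1, Tendsto (fun q : ℂ × ℝ => γ q.1 q.2) (𝓝 z₀ ×ˢ 𝓝[Icc 0 1] s)
      (𝓝 (γ z₀ s)))
    (hγ0 : ∀ᶠ z in 𝓝 z₀, γ z 0 = o)
    (hf : ∀ᶠ z in 𝓝 z₀, IsContinuationOn (γ z) (f z) (Icc 0 1))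
    (hf0 : ∀ᶠ z in 𝓝 z₀, f z 0 =ᶠ[𝓝 o] Y) {s : ℝ} (hs : s ∈ Icc (0 : ℝ) 1) :
    ∀ᶠ q : ℂ × ℝ in 𝓝 z₀ ×ˢ 𝓝[Icc 0 1] s, f q.1 q.2 =ᶠ[𝓝 (γ q.1 q.2)] f z₀ s := by
  have hf₀ := hf.self_of_nhds
  have h0 : (0 : ℝ) ∈ Icc (0 : ℝ) 1 := left_mem_Icc.2 zero_le_one
  have htend : ∀ a ∈ Icc (0 : ℝ) 1, Tendsto (fun z => γ z a) (𝓝 z₀) (𝓝 (γ z₀ a)) := fun a ha =>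
    (hγ a ha).comp (tendsto_id.prodMk (tendsto_const_pure.mono_right (pure_le_nhdsWithin ha)))
  -- near `s₀`, the continuations agree with `f z₀ s₀` if they do so somewhere
  have hloc : ∀ s₀ ∈ Icc (0 : ℝ) 1, ∃ N ∈ 𝓝[Icc 0 1] s₀, s₀ ∈ N ∧ N ⊆ Icc 0 1 ∧
      (∀ a ∈ N, f z₀ a =ᶠ[𝓝 (γ z₀ a)] f z₀ s₀) ∧
      ∀ᶠ z in 𝓝 z₀, ∀ a ∈ N, ∀ b ∈ N, f z a =ᶠ[𝓝 (γ z a)] f z₀ s₀ →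
        f z b =ᶠ[𝓝 (γ z b)] f z₀ s₀ := by
    intro s₀ hs₀
    obtain ⟨pa, hpa, pb, hpb, hab⟩ := eventually_prod_iff.1
      ((hγ s₀ hs₀).eventually (hf₀.analytic s₀ hs₀).eventually_analyticAt)
    obtain ⟨δ, hδ, hδN⟩ := Metric.mem_nhdsWithin_iff.1 (hpb.and (hf₀.compat s₀ hs₀))
    refine ⟨Metric.ball s₀ δ ∩ Icc 0 1, inter_comm _ _ ▸
      inter_mem_nhdsWithin _ (Metric.ball_mem_nhds s₀ hδ), ⟨Metric.mem_ball_self hδ, hs₀⟩,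
      inter_subset_right, fun a ha => (hδN ha).2, ?_⟩
    filter_upwards [hpa, hf] with z hz hfz a ha b hb h
    have hpre : IsPreconnected (Metric.ball s₀ δ ∩ Icc 0 1) :=
      ((convex_ball s₀ δ).inter (convex_Icc 0 1)).isPreconnected
    have hg := hfz.mono (T' := Metric.ball s₀ δ ∩ Icc 0 1) inter_subset_right
    exact (hg.eventuallyEq_iff (IsContinuationOn.const hg.continuousOn
      fun x hx => hab hz (hδN hx).1) hpre ha hb).1 h
  have hP : ∀ a ∈ Icc (0 : ℝ) 1, ∀ᶠ z in 𝓝 z₀, f z a =ᶠ[𝓝 (γ z a)] f z₀ a := by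
    intro a ha
    refine ((isPreconnected_Icc (a := (0 : ℝ)) (b := 1)).induction₂
      (fun a b => (∀ᶠ z in 𝓝 z₀, f z a =ᶠ[𝓝 (γ z a)] f z₀ a) ↔
        ∀ᶠ z in 𝓝 z₀, f z b =ᶠ[𝓝 (γ z b)] f z₀ b) ?_
      (fun x y z _ _ _ h h' => h.trans h') (fun x y _ _ h => h.symm) h0 ha).1 ?_
    · intro s₀ hs₀
      obtain ⟨N, hN, hs₀N, hN01, h1, h2⟩ := hloc s₀ hs₀
      have key : ∀ a ∈ N, (∀ᶠ z in 𝓝 z₀, f z a =ᶠ[𝓝 (γ z a)] f z₀ a) ↔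
          ∀ᶠ z in 𝓝 z₀, f z a =ᶠ[𝓝 (γ z a)] f z₀ s₀ := by
        intro a ha
        have := (htend a (hN01 ha)).eventually (eventually_eventuallyEq_nhds.2 (h1 a ha))
        exact ⟨fun h => by filter_upwards [h, this] with z e1 e2 using e1.trans e2,
          fun h => by filter_upwards [h, this] with z e1 e2 using e1.trans e2.symm⟩
      filter_upwards [hN] with b hb
      rw [key b hb]
      constructor
      · intro h
        filter_upwards [h, h2] with z e1 e2 using e2 _ hs₀N _ hb e1
      · intro h
        filter_upwards [h, h2] with z e1 e2 using e2 _ hb _ hs₀N e1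
    · filter_upwards [hf0, hγ0] with z e1 e2
      rw [e2]
      exact e1.trans hf0.self_of_nhds.symm
  obtain ⟨N, hN, hsN, hN01, h1, h2⟩ := hloc s hs
  -- `hP` alone is not uniform in the path parameter; `h2` spreads the agreement at `s` over all of
  -- `N` for the same `z`.
  refine eventually_prod_iff.2 ⟨_, (hP s hs).and h2, _, hN, ?_⟩
  intro z hz b hb
  exact hz.2 s hsN b hb hz.1

end EulerTransform

/-! ### Branches of the logarithm and the Euler transform -/

section EulerTransform

/-- The branch of `log (z - w)` near `(z₀, w₀)` with the value `a` at this point. -/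
noncomputable def logBranch (z₀ w₀ a : ℂ) (q : ℂ × ℂ) : ℂ :=
  a + Complex.log ((q.1 - q.2) / (z₀ - w₀))

variable {z₀ w₀ a : ℂ}

lemma logBranch_self (h : z₀ - w₀ ≠ 0) : logBranch z₀ w₀ a (z₀, w₀) = a := by
  simp [logBranch, div_self h]

lemma exp_logBranch (h : z₀ - w₀ ≠ 0) (ha : Complex.exp a = z₀ - w₀) {q : ℂ × ℂ}
    (hq : q.1 - q.2 ≠ 0) : Complex.exp (logBranch z₀ w₀ a q) = q.1 - q.2 := by
  rw [logBranch, Complex.exp_add, Complex.exp_log (div_ne_zero hq h), ha]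
  field_simp

lemma analyticAt_logBranch {q : ℂ × ℂ} (hq : (q.1 - q.2) / (z₀ - w₀) ∈ Complex.slitPlane) :
    AnalyticAt ℂ (logBranch z₀ w₀ a) q :=
  analyticAt_const.add (((analyticAt_fst.sub analyticAt_snd).div_const).clog hq)

lemma analyticAt_logBranch_self (h : z₀ - w₀ ≠ 0) :
    AnalyticAt ℂ (logBranch z₀ w₀ a) (z₀, w₀) :=
  analyticAt_logBranch (by simp [div_self h, Complex.one_mem_slitPlane])

lemma hasDerivAt_logBranch_fst (h : z₀ - w₀ ≠ 0) :
    HasDerivAt (fun z => logBranch z₀ w₀ a (z, w₀)) (1 / (z₀ - w₀)) z₀ := by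
  have h1 : HasDerivAt (fun z => (z - w₀) / (z₀ - w₀)) (1 / (z₀ - w₀)) z₀ :=
    ((hasDerivAt_id z₀).sub_const w₀).div_const _
  have h2 := (h1.clog (by simp [div_self h, Complex.one_mem_slitPlane])).const_add a
  rwa [div_self h, div_one] at h2

lemma hasDerivAt_logBranch_snd (h : z₀ - w₀ ≠ 0) :
    HasDerivAt (fun w => logBranch z₀ w₀ a (z₀, w)) (-1 / (z₀ - w₀)) w₀ := by
  have h1 : HasDerivAt (fun w => (z₀ - w) / (z₀ - w₀)) (-1 / (z₀ - w₀)) w₀ :=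
    ((hasDerivAt_id w₀).const_sub z₀).div_const _
  have h2 := (h1.clog (by simp [div_self h, Complex.one_mem_slitPlane])).const_add a
  rwa [div_self h, div_one] at h2

variable {E : Type*} [NormedAddCommGroup E] [NormedSpace ℂ E] [CompleteSpace E]

/-- The Euler transform `∮ C(w) y(w) (z - w) ^ κ dw` of a solution of a linear system along a closed
lift. -/
theorem hasDerivAt_eulerTransform {S : Set ℂ} (hS : IsClosed S) {U : Set ℂ} (hU : IsOpen U)
    (hUS : ∀ z ∈ U, z ∉ S) {A B C : ℂ → E →L[ℂ] E} (hC : DifferentiableOn ℂ C Sᶜ) {κ : ℂ}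
    (hint : ∀ z w, z ∉ S → w ∉ S → ∀ v,
      κ • (C z v - C w v) = (z - w) • (C z (A w v) - B z (C w v)))
    (hA : DifferentiableOn ℂ A Sᶜ)
    {o : ℂ} {γ : ℂ → ℝ → ℂ} {f : ℂ → ℝ → ℂ → E} {ℓ : ℂ → ℝ → ℂ} {Y : ℂ → E}
    (hγc : ContinuousOn (fun q : ℂ × ℝ => γ q.1 q.2) (U ×ˢ Icc (0 : ℝ) 1))
    (hγp : ∀ z ∈ U, IsPiecewiseSmooth (γ z)) (hγ0 : ∀ z ∈ U, γ z 0 = o) (hγ1 : ∀ z ∈ U, γ z 1 = o)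
    (hγS : ∀ z ∈ U, ∀ s ∈ Icc (0 : ℝ) 1, γ z s ∉ S)
    (hf : ∀ z ∈ U, IsContinuationOn (γ z) (f z) (Icc 0 1)) (hf0 : ∀ z ∈ U, f z 0 =ᶠ[𝓝 o] Y)
    (hode : ∀ z ∈ U, ∀ s ∈ Icc (0 : ℝ) 1, ∀ᶠ w in 𝓝 (γ z s), HasDerivAt (f z s) (A w (f z s w)) w)
    (hf1 : ∀ z ∈ U, f z 1 o = f z 0 o)
    (hℓ : ContinuousOn (fun q : ℂ × ℝ => ℓ q.1 q.2) (U ×ˢ Icc (0 : ℝ) 1))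
    (hexp : ∀ z ∈ U, ∀ s ∈ Icc (0 : ℝ) 1, Complex.exp (ℓ z s) = z - γ z s)
    (hℓ1 : ∀ z ∈ U, ℓ z 1 = ℓ z 0) {z₀ : ℂ} (hz₀ : z₀ ∈ U) :
    HasDerivAt
      (fun z => ∫ s in (0 : ℝ)..1, deriv (γ z) s •
        C (γ z s) (Complex.exp (κ * ℓ z s) • f z s (γ z s)))
      (B z₀ (∫ s in (0 : ℝ)..1, deriv (γ z₀) s •
        C (γ z₀ s) (Complex.exp (κ * ℓ z₀ s) • f z₀ s (γ z₀ s)))) z₀ := by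
  have hnhds : ∀ s : ℝ, 𝓝[U ×ˢ Icc (0 : ℝ) 1] (z₀, s) = 𝓝 z₀ ×ˢ 𝓝[Icc 0 1] s := fun s => by
    rw [nhdsWithin_prod_eq, hU.nhdsWithin_eq hz₀]
  have hUe : ∀ᶠ z in 𝓝 z₀, z ∈ U := hU.mem_nhds hz₀
  have hγt : ∀ s ∈ Icc (0 : ℝ) 1, Tendsto (fun q : ℂ × ℝ => γ q.1 q.2) (𝓝 z₀ ×ˢ 𝓝[Icc 0 1] s)
      (𝓝 (γ z₀ s)) := fun s hs => hnhds s ▸ hγc (z₀, s) ⟨hz₀, hs⟩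
  have hℓt : ∀ s ∈ Icc (0 : ℝ) 1, Tendsto (fun q : ℂ × ℝ => ℓ q.1 q.2) (𝓝 z₀ ×ˢ 𝓝[Icc 0 1] s)
      (𝓝 (ℓ z₀ s)) := fun s hs => hnhds s ▸ hℓ (z₀, s) ⟨hz₀, hs⟩
  have hslice : ∀ z ∈ U, MapsTo (fun s : ℝ => (z, s)) (Icc 0 1) (U ×ˢ Icc (0 : ℝ) 1) :=
    fun z hz s hs => ⟨hz, hs⟩
  have hγzc : ∀ z ∈ U, ContinuousOn (γ z) (Icc 0 1) := fun z hz =>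
    hγc.comp (f := fun s : ℝ => (z, s)) (by fun_prop) (hslice z hz)
  have hℓzc : ∀ z ∈ U, ContinuousOn (ℓ z) (Icc 0 1) := fun z hz =>
    hℓ.comp (f := fun s : ℝ => (z, s)) (by fun_prop) (hslice z hz)
  have hne : ∀ z ∈ U, ∀ s ∈ Icc (0 : ℝ) 1, z - γ z s ≠ 0 := fun z hz s hs => by
    rw [← hexp z hz s hs]; exact Complex.exp_ne_zero _
  -- the solution along the path, times the power function
  set u : ℂ → ℝ → E := fun z s => Complex.exp (κ * ℓ z s) • f z s (γ z s) with hu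
  have huc : ∀ z ∈ U, ContinuousOn (u z) (Icc 0 1) := by
    intro z hz
    refine ContinuousOn.smul (by have := hℓzc z hz; fun_prop) fun s hs => ?_
    have h1 : ContinuousWithinAt (fun s' => f z s (γ z s')) (Icc 0 1) s :=
      ((hf z hz).analytic s hs).continuousAt.comp_continuousWithinAt (hγzc z hz s hs)
    refine h1.congr_of_eventuallyEq_of_mem ?_ hs
    filter_upwards [(hf z hz).compat s hs] with s' hs' using hs'.self_of_nhds
  have hφc : ∀ z ∈ U, ContinuousOn (fun s => C (γ z s) (u z s)) (Icc 0 1) := fun z hz =>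
    (hC.continuousOn.comp (hγzc z hz) (hγS z hz)).clm_apply (huc z hz)
  have hCa : ∀ w ∉ S, AnalyticAt ℂ C w := fun w hw =>
    hC.analyticAt (hS.isOpen_compl.mem_nhds hw)
  -- local function elements for the power function
  have hlog : ∀ s ∈ Icc (0 : ℝ) 1, ∀ᶠ q : ℂ × ℝ in 𝓝 z₀ ×ˢ 𝓝[Icc 0 1] s,
      ℓ q.1 q.2 = logBranch z₀ (γ z₀ s) (ℓ z₀ s) (q.1, γ q.1 q.2) := by
    intro s hs
    have hn := hne z₀ hz₀ s hs
    refine eventuallyEq_of_exp_eq (hℓt s hs) ?_ ?_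
    · have h1 : Tendsto (fun q : ℂ × ℝ => (q.1, γ q.1 q.2)) (𝓝 z₀ ×ˢ 𝓝[Icc 0 1] s)
          (𝓝 (z₀, γ z₀ s)) := tendsto_fst.prodMk_nhds (hγt s hs)
      have h2 := (analyticAt_logBranch_self (a := ℓ z₀ s) hn).continuousAt.tendsto.comp h1
      rwa [logBranch_self hn] at h2
    · filter_upwards [hUe.prod_mk self_mem_nhdsWithin] with q hq
      rw [exp_logBranch hn (hexp z₀ hz₀ s hs) (hne q.1 hq.1 q.2 hq.2), hexp q.1 hq.1 q.2 hq.2]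
  have hlog₀ : ∀ s ∈ Icc (0 : ℝ) 1, ∀ᶠ s' in 𝓝[Icc 0 1] s,
      ℓ z₀ s' = logBranch z₀ (γ z₀ s) (ℓ z₀ s) (z₀, γ z₀ s') := fun s hs =>
    (hlog s hs).curry.self_of_nhds
  have hlogc : ∀ s ∈ Icc (0 : ℝ) 1, ∀ᶠ s' in 𝓝[Icc 0 1] s,
      logBranch z₀ (γ z₀ s') (ℓ z₀ s') =ᶠ[𝓝 (z₀, γ z₀ s')] logBranch z₀ (γ z₀ s) (ℓ z₀ s) := by
    intro s hs
    have hn := hne z₀ hz₀ s hs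
    have hslit : ∀ᶠ s' in 𝓝[Icc 0 1] s, (z₀ - γ z₀ s') / (z₀ - γ z₀ s) ∈ Complex.slitPlane := by
      have h1 : ContinuousWithinAt (fun s' => (z₀ - γ z₀ s') / (z₀ - γ z₀ s)) (Icc 0 1) s :=
        ((continuousWithinAt_const.sub (hγzc z₀ hz₀ s hs)).div_const _)
      refine h1.eventually (Complex.isOpen_slitPlane.mem_nhds ?_)
      simp [div_self hn, Complex.one_mem_slitPlane]
    filter_upwards [hlog₀ s hs, hslit, self_mem_nhdsWithin] with s' e1 e2 hs'
    have hn' := hne z₀ hz₀ s' hs'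
    have t1 := (analyticAt_logBranch_self (a := ℓ z₀ s') hn').continuousAt.tendsto
    have t2 := (analyticAt_logBranch (z₀ := z₀) (w₀ := γ z₀ s) (a := ℓ z₀ s)
      (q := (z₀, γ z₀ s')) e2).continuousAt.tendsto
    rw [logBranch_self hn'] at t1
    rw [← e1] at t2
    refine eventuallyEq_of_exp_eq t1 t2 ?_
    have h3 : ∀ᶠ q : ℂ × ℂ in 𝓝 (z₀, γ z₀ s'), q.1 - q.2 ≠ 0 :=
      (continuous_fst.sub continuous_snd).continuousAt.eventually_ne hn'
    filter_upwards [h3] with q hq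
    rw [exp_logBranch hn (hexp z₀ hz₀ s hs) hq, exp_logBranch hn' (hexp z₀ hz₀ s' hs') hq]
  -- local function elements for the solution times the power function
  set G : ℝ → ℂ × ℂ → E := fun s q =>
    Complex.exp (κ * logBranch z₀ (γ z₀ s) (ℓ z₀ s) q) • f z₀ s q.2 with hG
  have hGa : ∀ s ∈ Icc (0 : ℝ) 1, AnalyticAt ℂ (G s) (z₀, γ z₀ s) := by
    intro s hs
    have h1 : AnalyticAt ℂ (fun q : ℂ × ℂ => f z₀ s q.2) (z₀, γ z₀ s) :=
      AnalyticAt.comp (f := Prod.snd) ((hf z₀ hz₀).analytic s hs) analyticAt_snd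
    exact (analyticAt_const.mul (analyticAt_logBranch_self (hne z₀ hz₀ s hs))).cexp.smul h1
  have hGc : ∀ s ∈ Icc (0 : ℝ) 1, ∀ᶠ s' in 𝓝[Icc 0 1] s, G s' =ᶠ[𝓝 (z₀, γ z₀ s')] G s := by
    intro s hs
    filter_upwards [hlogc s hs, (hf z₀ hz₀).compat s hs] with s' e1 e2
    filter_upwards [e1, (continuousAt_snd (p := (z₀, γ z₀ s'))).eventually e2] with q h1 h2
    simp only [hG, h1, h2]
  have hGu : ∀ s ∈ Icc (0 : ℝ) 1, ∀ᶠ q : ℂ × ℝ in 𝓝 z₀ ×ˢ 𝓝[Icc 0 1] s,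
      u q.1 q.2 = G s (q.1, γ q.1 q.2) := by
    intro s hs
    filter_upwards [hlog s hs, eventually_continuation_eventuallyEq hγt (hUe.mono hγ0)
      (hUe.mono hf) (hUe.mono hf0) hs] with q e1 e2
    simp only [hu, hG, e1, e2.self_of_nhds]
  -- differentiation under the integral sign
  have hmain := hasDerivAt_integral_deformation (z₀ := z₀) (o := o) (o' := o) (γ := γ)
    (H := fun s q => C q.2 (G s q)) (φ := fun z s => C (γ z s) (u z s)) hγt (hUe.mono hγp)
    (hUe.mono hγzc) (hUe.mono hγ0) (hUe.mono hγ1) (hUe.mono hφc)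
    (fun s hs => analyticAt_clm_apply
      (AnalyticAt.comp (f := Prod.snd) (hCa _ (hγS z₀ hz₀ s hs)) analyticAt_snd) (hGa s hs))
    (fun s hs => (hGc s hs).mono fun s' h => h.mono fun q hq => by simp only [hq])
    (fun s hs => (hGu s hs).mono fun q hq => by simp only [hq])
  refine hmain.congr_deriv ?_
  -- the derivative of the integrand with respect to the parameter
  have hD : ∀ s ∈ Icc (0 : ℝ) 1, fderiv ℂ (fun q => C q.2 (G s q)) (z₀, γ z₀ s) (1, 0)
      = B z₀ (C (γ z₀ s) (u z₀ s)) - C z₀ (A (γ z₀ s) (u z₀ s) - (κ / (z₀ - γ z₀ s)) • u z₀ s) := by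
    intro s hs
    have hn := hne z₀ hz₀ s hs
    have h1 := (analyticAt_clm_apply (AnalyticAt.comp (f := Prod.snd) (x := (z₀, γ z₀ s))
      (hCa _ (hγS z₀ hz₀ s hs)) analyticAt_snd) (hGa s hs)).differentiableAt.hasFDerivAt
    have h2 : HasDerivAt (fun z : ℂ => (z, γ z₀ s)) ((1 : ℂ), (0 : ℂ)) z₀ :=
      (hasDerivAt_id z₀).prodMk (hasDerivAt_const z₀ _)
    have h3 := h1.comp_hasDerivAt z₀ h2
    have h4 : HasDerivAt (fun z => C (γ z₀ s) (G s (z, γ z₀ s)))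
        (C (γ z₀ s) ((κ / (z₀ - γ z₀ s)) • u z₀ s)) z₀ := by
      refine (C (γ z₀ s)).hasFDerivAt.comp_hasDerivAt z₀ ?_
      have h5 := (((hasDerivAt_logBranch_fst (a := ℓ z₀ s) hn).const_mul κ).cexp).smul_const
        (f z₀ s (γ z₀ s))
      refine h5.congr_deriv ?_
      rw [logBranch_self hn, hu, smul_smul]
      congr 1
      ring
    have h6 := h3.unique h4
    simp only [Function.comp_def] at h6
    rw [h6]
    -- The kernel identity replaces `κ/(z - w) C(w)` by `κ/(z - w) C(z) - C(z) A(w) + B(z) C(w)`,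
    -- which moves the singular factor onto `C(z)`, constant along the path.
    have h7 := hint z₀ (γ z₀ s) (hUS z₀ hz₀) (hγS z₀ hz₀ s hs) (u z₀ s)
    have h8 : (κ / (z₀ - γ z₀ s)) • (C z₀ (u z₀ s) - C (γ z₀ s) (u z₀ s))
        = C z₀ (A (γ z₀ s) (u z₀ s)) - B z₀ (C (γ z₀ s) (u z₀ s)) := by
      rw [div_eq_inv_mul, mul_smul, h7, inv_smul_smul₀ hn]
    rw [smul_sub] at h8
    generalize u z₀ s = x at h8 ⊢
    rw [map_smul, map_sub, map_smul, eq_add_of_sub_eq h8.symm]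
    abel
  -- a total derivative
  have hvc : ContinuousOn (fun s => A (γ z₀ s) (u z₀ s) - (κ / (z₀ - γ z₀ s)) • u z₀ s)
      (Icc 0 1) := by
    refine ((hA.continuousOn.comp (hγzc z₀ hz₀) (hγS z₀ hz₀)).clm_apply (huc z₀ hz₀)).sub
      (ContinuousOn.smul (continuousOn_const.div (continuousOn_const.sub (hγzc z₀ hz₀))
        (hne z₀ hz₀)) (huc z₀ hz₀))
  have hi1 := (hγp z₀ hz₀).intervalIntegrable (hφc z₀ hz₀)
  have hi2 := (hγp z₀ hz₀).intervalIntegrable hvc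
  have htot : ∫ s in (0 : ℝ)..1, deriv (γ z₀) s •
      (A (γ z₀ s) (u z₀ s) - (κ / (z₀ - γ z₀ s)) • u z₀ s) = 0 := by
    obtain ⟨T, hT, M, hM⟩ := hγp z₀ hz₀
    have h01 : uIcc (0 : ℝ) 1 = Icc 0 1 := uIcc_of_le zero_le_one
    rw [MeasureTheory.integral_eq_of_hasDerivAt_off_countable (u z₀) _ hT
      (by rw [h01]; exact huc z₀ hz₀) ?_ hi2]
    · simp only [hu, hγ0 z₀ hz₀, hγ1 z₀ hz₀, hf1 z₀ hz₀, hℓ1 z₀ hz₀, sub_self]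
    · intro s hs
      have hs' : s ∈ Ioo (0 : ℝ) 1 := by simpa using hs.1
      have hsI := Ioo_subset_Icc_self hs'
      have hn := hne z₀ hz₀ s hsI
      have hIcc : 𝓝[Icc (0 : ℝ) 1] s = 𝓝 s := nhdsWithin_eq_nhds.2 (Icc_mem_nhds hs'.1 hs'.2)
      have e1 : u z₀ =ᶠ[𝓝 s] fun s' => G s (z₀, γ z₀ s') := by
        rw [← hIcc]
        exact (hGu s hsI).curry.self_of_nhds
      have h1 : HasDerivAt (fun w => G s (z₀, w))
          (A (γ z₀ s) (u z₀ s) - (κ / (z₀ - γ z₀ s)) • u z₀ s) (γ z₀ s) := by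
        have h2 := (((hasDerivAt_logBranch_snd (a := ℓ z₀ s) hn).const_mul κ).cexp).smul
          (hode z₀ hz₀ s hsI).self_of_nhds
        refine h2.congr_deriv ?_
        rw [logBranch_self hn, hu, map_smul, smul_smul, show Complex.exp (κ * ℓ z₀ s) *
          (κ * (-1 / (z₀ - γ z₀ s))) = -(κ / (z₀ - γ z₀ s) * Complex.exp (κ * ℓ z₀ s)) by ring,
          neg_smul, ← sub_eq_add_neg]
      exact (h1.scomp s (hM s ⟨hsI, hs.2⟩).1.hasDerivAt).congr_of_eventuallyEq e1
  have hcongr : ∫ s in (0 : ℝ)..1, deriv (γ z₀) s •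
        fderiv ℂ (fun q => C q.2 (G s q)) (z₀, γ z₀ s) (1, 0)
      = ∫ s in (0 : ℝ)..1, (B z₀ (deriv (γ z₀) s • C (γ z₀ s) (u z₀ s)) - C z₀ (deriv (γ z₀) s •
        (A (γ z₀ s) (u z₀ s) - (κ / (z₀ - γ z₀ s)) • u z₀ s))) := by
    refine intervalIntegral.integral_congr fun s hs => ?_
    rw [uIcc_of_le (zero_le_one' ℝ)] at hs
    rw [hD s hs, (B z₀).map_smul (deriv (γ z₀) s), (C z₀).map_smul (deriv (γ z₀) s), smul_sub]
  rw [hcongr, intervalIntegral.integral_sub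
      ⟨(B z₀).integrable_comp hi1.1, (B z₀).integrable_comp hi1.2⟩
      ⟨(C z₀).integrable_comp hi2.1, (C z₀).integrable_comp hi2.2⟩,
    ContinuousLinearMap.intervalIntegral_comp_comm _ hi1,
    ContinuousLinearMap.intervalIntegral_comp_comm _ hi2, htot, map_zero, sub_zero]

end EulerTransform

/-! ### Application to the given system -/

/-- Matrix-vector multiplication as a continuous linear map, linear in the matrix. -/
noncomputable def mulVecCLM :
    Matrix (Fin 2) (Fin 2) ℂ →ₗ[ℂ] (Fin 2 → ℂ) →L[ℂ] (Fin 2 → ℂ) :=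
  LinearMap.toContinuousLinearMap.toLinearMap ∘ₗ Matrix.toLin'.toLinearMap

lemma mulVecCLM_apply (M : Matrix (Fin 2) (Fin 2) ℂ) (v : Fin 2 → ℂ) : mulVecCLM M v = M *ᵥ v :=
  rfl

lemma differentiableOn_mulVecCLM_partialFractions (t : ℂ) (M₀ M₁ Mt : Matrix (Fin 2) (Fin 2) ℂ) :
    DifferentiableOn ℂ (fun z => mulVecCLM (partialFractions t M₀ M₁ Mt z)) {0, 1, t}ᶜ := by
  simp only [partialFractions, map_add, map_smul]
  intro z hz
  simp only [mem_compl_iff, mem_insert_iff, mem_singleton_iff, not_or] at hz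
  obtain ⟨h0, h1, h2⟩ := hz
  have h1' : z - 1 ≠ 0 := sub_ne_zero.2 h1
  have h2' : z - t ≠ 0 := sub_ne_zero.2 h2
  refine DifferentiableAt.differentiableWithinAt ?_
  refine DifferentiableAt.add (DifferentiableAt.add (DifferentiableAt.smul_const ?_ _)
    (DifferentiableAt.smul_const ?_ _)) (DifferentiableAt.smul_const ?_ _)
  · exact differentiableAt_id.inv h0
  · exact (differentiableAt_id.sub_const 1).inv h1'
  · exact (differentiableAt_id.sub_const t).inv h2'

end FuchsianMC
open FuchsianMC

theorem mainTheorem1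
    (t θ₀ θ₁ θt θi lam mu k : ℂ)
    (ht : t ≠ 0 ∧ t ≠ 1) (hk : k ≠ 0) (hmu : mu ≠ 0)
    (hθi : θi ≠ 0) (hκ₂ : kappa2 θ₀ θ₁ θt θi ≠ 0)
    (hlam : lam ∉ ({0, 1, t} : Set ℂ))
    (hlamt : lam + kappa1 θ₀ θ₁ θt θi / mu ∉ ({0, 1, t} : Set ℂ))
    -- a solution `Y` near the base point `o`
    (o : ℂ) (ho : o ∉ ({0, 1, t} : Set ℂ))
    (Y : ℂ → Fin 2 → ℂ)
    (hY : ∀ᶠ w in 𝓝 o, SolvesAt t θ₀ θ₁ θt θi lam mu k Y w)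
    (i : OnePoint ℂ)
    (hi : i ∈ ({((0 : ℂ) : OnePoint ℂ), ((1 : ℂ) : OnePoint ℂ), (t : OnePoint ℂ),
      OnePoint.infty} : Set (OnePoint ℂ)))
    -- the Pochhammer contours `γ z = [α_z, α_i]`, for `z` in the open set `U`
    (U : Set ℂ) (hU : IsOpen U) (hUt : ∀ z ∈ U, z ∉ ({0, 1, t} : Set ℂ))
    (α β : ℂ → Path o o)
    (hα : ∀ z ∈ U, IsCycle {0, 1, t, z} (z : OnePoint ℂ) (α z))
    (hβ : ∀ z ∈ U, IsCycle {0, 1, t, z} i (β z))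
    (γ : ℂ → ℝ → ℂ)
    (hγ : ∀ z s, γ z s = (pochhammer (α z) (β z)).extend s)
    (hγc : ContinuousOn (fun q : ℂ × ℝ => γ q.1 q.2) (U ×ˢ Icc (0 : ℝ) 1))
    -- the continuation of `Y` along the contours
    (f : ℂ → ℝ → ℂ → Fin 2 → ℂ)
    (hf : ∀ z ∈ U, IsContinuation (γ z) Y (f z))
    -- a branch of `log (z - w)` along the contours
    (ℓ : ℂ → ℝ → ℂ)
    (hℓ : ContinuousOn (fun q : ℂ × ℝ => ℓ q.1 q.2) (U ×ˢ Icc (0 : ℝ) 1))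
    (hexp : ∀ z ∈ U, ∀ s ∈ Icc (0 : ℝ) 1, Complex.exp (ℓ z s) = z - γ z s)
    (Yt : ℂ → Fin 2 → ℂ)
    (hYt : ∀ z ∈ U, Yt z =
      ![∫ s in (0 : ℝ)..1, integrand1 (kappa1 θ₀ θ₁ θt θi) lam
            (lam + kappa1 θ₀ θ₁ θt θi / mu) (γ z) (f z) (ℓ z) s,
        -θi / kappa2 θ₀ θ₁ θt θi *
          ∫ s in (0 : ℝ)..1, integrand2 (kappa1 θ₀ θ₁ θt θi) (γ z) (f z) (ℓ z) s]) :
    (∀ z ∈ U,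
      IntervalIntegrable (integrand1 (kappa1 θ₀ θ₁ θt θi) lam
        (lam + kappa1 θ₀ θ₁ θt θi / mu) (γ z) (f z) (ℓ z)) MeasureTheory.volume 0 1 ∧
      IntervalIntegrable (integrand2 (kappa1 θ₀ θ₁ θt θi) (γ z) (f z) (ℓ z))
        MeasureTheory.volume 0 1) ∧
    ∀ z ∈ U,
      SolvesAt t (kappa1 θ₀ θ₁ θt θi + θ₀) (kappa1 θ₀ θ₁ θt θi + θ₁) (kappa1 θ₀ θ₁ θt θi + θt)
        (-kappa2 θ₀ θ₁ θt θi) (lam + kappa1 θ₀ θ₁ θt θi / mu) mu k Yt z := by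
  obtain ⟨N₀, N₁, Nt, hN, hN0, hN1⟩ := exists_kernel ht hk hmu hθi hκ₂ hlam hlamt
  set κ := kappa1 θ₀ θ₁ θt θi with hκ
  set S : Set ℂ := {0, 1, t} with hS
  have hSc : IsClosed S := (Set.toFinite S).isClosed
  set A : ℂ → (Fin 2 → ℂ) →L[ℂ] (Fin 2 → ℂ) :=
    fun w => mulVecCLM (coeffMatrix t θ₀ θ₁ θt θi lam mu k w) with hA
  set C : ℂ → (Fin 2 → ℂ) →L[ℂ] (Fin 2 → ℂ) :=
    fun w => mulVecCLM (partialFractions t N₀ N₁ Nt w) with hC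
  have hAd : DifferentiableOn ℂ A Sᶜ := differentiableOn_mulVecCLM_partialFractions _ _ _ _
  have hCd : DifferentiableOn ℂ C Sᶜ := differentiableOn_mulVecCLM_partialFractions _ _ _ _
  have h0 : (0 : ℝ) ∈ Icc (0 : ℝ) 1 := left_mem_Icc.2 zero_le_one
  have h1 : (1 : ℝ) ∈ Icc (0 : ℝ) 1 := right_mem_Icc.2 zero_le_one
  have hins : ∀ z : ℂ, ({0, 1, t, z} : Set ℂ) = insert z S := by
    intro z
    ext w
    simp only [hS, mem_insert_iff, mem_singleton_iff]
    tauto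
  -- the contours
  have hγe : ∀ z, γ z = (pochhammer (α z) (β z)).extend := fun z => funext (hγ z)
  have hγ0 : ∀ z, γ z 0 = o := fun z => by rw [hγe, Path.extend_zero]
  have hγ1 : ∀ z, γ z 1 = o := fun z => by rw [hγe, Path.extend_one]
  have hγp : ∀ z ∈ U, IsPiecewiseSmooth (γ z) := fun z hz => by
    rw [hγe]
    exact (hα z hz).isPiecewiseSmooth.pochhammer (hβ z hz).isPiecewiseSmooth
  have hγS : ∀ z ∈ U, ∀ s ∈ Icc (0 : ℝ) 1, γ z s ∉ S := by
    intro z hz s hs hsS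
    rw [hγ, Path.extend_apply _ hs] at hsS
    have hsS' : pochhammer (α z) (β z) ⟨s, hs⟩ ∈ ({0, 1, t, z} : Set ℂ) := hins z ▸ Or.inr hsS
    have hr : pochhammer (α z) (β z) ⟨s, hs⟩ ∈ range (pochhammer (α z) (β z)) := mem_range_self _
    rw [pochhammer, Path.trans_range, Path.trans_range, Path.trans_range, Path.symm_range,
      Path.symm_range] at hr
    obtain (⟨x, hx⟩ | ⟨x, hx⟩) | (⟨x, hx⟩ | ⟨x, hx⟩) := hr
    · exact (hα z hz).notMem x (hx ▸ hsS')
    · exact (hβ z hz).notMem x (hx ▸ hsS')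
    · exact (hα z hz).notMem x (hx ▸ hsS')
    · exact (hβ z hz).notMem x (hx ▸ hsS')
  -- the continuation of the solution
  have hfc : ∀ z ∈ U, IsContinuationOn (γ z) (f z) (Icc 0 1) := fun z hz =>
    ⟨by rw [hγe]; exact (Path.continuous_extend _).continuousOn, (hf z hz).analytic,
      (hf z hz).compat⟩
  have hf0 : ∀ z ∈ U, f z 0 =ᶠ[𝓝 o] Y := fun z hz => by
    have := (hf z hz).start
    rwa [hγ0] at this
  have hode : ∀ z ∈ U, ∀ s ∈ Icc (0 : ℝ) 1,
      ∀ᶠ w in 𝓝 (γ z s), HasDerivAt (f z s) (A w (f z s w)) w := by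
    intro z hz s hs
    refine (hfc z hz).eventually_hasDerivAt isPreconnected_Icc (fun s hs =>
      hAd.analyticAt (hSc.isOpen_compl.mem_nhds (hγS z hz s hs))) h0 hs ?_
    rw [hγ0]
    filter_upwards [hY, (hf0 z hz).eventuallyEq_nhds] with w hw hw'
    rw [hw'.self_of_nhds]
    exact HasDerivAt.congr_of_eventuallyEq hw hw'
  -- The system is regular at `z`, so continuation along `α z` is trivial on both the first and the
  -- third quarter of the contour.
  have hf1 : ∀ z ∈ U, f z 1 =ᶠ[𝓝 o] f z 0 := by
    intro z hz
    have hc := hfc z hz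
    rw [hγe] at hc
    have hcyc := hα z hz
    rw [hins] at hcyc
    refine hc.pochhammer_eventuallyEq ?_ ?_
    · have e : ∀ x ∈ Icc (0 : ℝ) 1, (α z).extend x
          = (pochhammer (α z) (β z)).extend ((1 - x) / 4) := fun x hx => by
        rw [pochhammer_extend_first _ _ ⟨by linarith [hx.2], by linarith [hx.1]⟩, sub_sub_cancel]
      have d : IsContinuationOn (α z).extend (f z ∘ fun x => (1 - x) / 4) (Icc 0 1) :=
        hc.comp (by fun_prop) (fun x hx => ⟨by linarith [hx.2], by linarith [hx.1]⟩) e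
      have := hcyc.eventuallyEq_of_holomorphic hSc (hUt z hz) hAd d fun s hs => by
        rw [e s hs, ← hγe]
        exact hode z hz _ ⟨by linarith [hs.2], by linarith [hs.1]⟩
      simpa [Function.comp_def] using this
    · have e : ∀ x ∈ Icc (0 : ℝ) 1, (α z).extend x
          = (pochhammer (α z) (β z)).extend ((2 + x) / 4) := fun x hx =>
        (pochhammer_extend_third _ _ hx).symm
      have d : IsContinuationOn (α z).extend (f z ∘ fun x => (2 + x) / 4) (Icc 0 1) :=
        hc.comp (by fun_prop) (fun x hx => ⟨by linarith [hx.1], by linarith [hx.2]⟩) e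
      have := hcyc.eventuallyEq_of_holomorphic hSc (hUt z hz) hAd d fun s hs => by
        rw [e s hs, ← hγe]
        exact hode z hz _ ⟨by linarith [hs.1], by linarith [hs.2]⟩
      norm_num [Function.comp_def] at this ⊢
      exact this
  -- the integrands
  have hslice : ∀ z ∈ U, MapsTo (fun s : ℝ => (z, s)) (Icc 0 1) (U ×ˢ Icc (0 : ℝ) 1) :=
    fun z hz s hs => ⟨hz, hs⟩
  have hℓzc : ∀ z ∈ U, ContinuousOn (ℓ z) (Icc 0 1) := fun z hz =>
    hℓ.comp (f := fun s : ℝ => (z, s)) (by fun_prop) (hslice z hz)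
  set u : ℂ → ℝ → Fin 2 → ℂ := fun z s => Complex.exp (κ * ℓ z s) • f z s (γ z s) with hu
  have huc : ∀ z ∈ U, ContinuousOn (u z) (Icc 0 1) := by
    intro z hz
    refine ContinuousOn.smul (continuousOn_const.mul (hℓzc z hz)).cexp fun s hs => ?_
    have h1 : ContinuousWithinAt (fun s' => f z s (γ z s')) (Icc 0 1) s :=
      ((hfc z hz).analytic s hs).continuousAt.comp_continuousWithinAt ((hfc z hz).continuousOn s hs)
    refine h1.congr_of_eventuallyEq_of_mem ?_ hs
    filter_upwards [(hfc z hz).compat s hs] with s' hs' using hs'.self_of_nhds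
  have hderiv : ∀ z ∈ U, ∀ s ∈ Icc (0 : ℝ) 1, ∀ j,
      deriv (fun w => f z s w j) (γ z s) = A (γ z s) (f z s (γ z s)) j := fun z hz s hs j =>
    (hasDerivAt_pi.1 (hode z hz s hs).self_of_nhds j).deriv
  set Φ : ℂ → ℝ → Fin 2 → ℂ := fun z s => deriv (γ z) s • C (γ z s) (u z s) with hΦ
  have hΦi : ∀ z ∈ U, IntervalIntegrable (Φ z) MeasureTheory.volume 0 1 := fun z hz =>
    (hγp z hz).intervalIntegrable ((hCd.continuousOn.comp (hfc z hz).continuousOn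
      (hγS z hz)).clm_apply (huc z hz))
  have hΦj : ∀ z ∈ U, ∀ j : Fin 2,
      IntervalIntegrable (fun s => Φ z s j) MeasureTheory.volume 0 1 := fun z hz j =>
    ⟨(ContinuousLinearMap.proj (R := ℂ) (φ := fun _ : Fin 2 => ℂ) j).integrable_comp (hΦi z hz).1,
      (ContinuousLinearMap.proj (R := ℂ) (φ := fun _ : Fin 2 => ℂ) j).integrable_comp (hΦi z hz).2⟩
  have hI : uIoc (0 : ℝ) 1 ⊆ Icc 0 1 := by
    rw [uIoc_of_le zero_le_one]; exact Ioc_subset_Icc_self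
  -- The contour may pass through λ, where the written integrand is `0` by division by zero while
  -- the kernel is regular. Where `γ` has derivative zero both sides vanish, so they can differ only
  -- at the countably many parameters at which the path meets λ with nonzero derivative.
  have hint1 : ∀ z ∈ U, (fun s => Φ z s 0) =ᵐ[MeasureTheory.volume.restrict (uIoc 0 1)]
      integrand1 κ lam (lam + κ / mu) (γ z) (f z) (ℓ z) := by
    intro z hz
    rw [EventuallyEq, MeasureTheory.ae_restrict_iff' measurableSet_uIoc]
    filter_upwards [(countable_eq_and_deriv_ne_zero (γ z) lam).ae_notMem MeasureTheory.volume]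
      with s hs hs'
    have hsI := hI hs'
    simp only [not_and, not_not] at hs
    by_cases hl : γ z s = lam
    · simp [hΦ, integrand1, hs hl]
    · simp only [hΦ, integrand1, hderiv z hz s hsI, hu, hC, hA, mulVecCLM_apply, map_smul,
        Pi.smul_apply, smul_eq_mul, hN0 _ _ (hγS z hz s hsI) hl]
      ring
  have hint2 : ∀ z ∈ U, ∀ s ∈ Icc (0 : ℝ) 1, Φ z s 1
      = -θi / kappa2 θ₀ θ₁ θt θi * integrand2 κ (γ z) (f z) (ℓ z) s := by
    intro z hz s hs
    simp only [hΦ, integrand2, hderiv z hz s hs, hu, hC, hA, mulVecCLM_apply, map_smul,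
      Pi.smul_apply, smul_eq_mul, hN1]
    ring
  have hq : -θi / kappa2 θ₀ θ₁ θt θi ≠ 0 := div_ne_zero (neg_ne_zero.2 hθi) hκ₂
  refine ⟨fun z hz => ⟨(hΦj z hz 0).congr_ae (hint1 z hz), ?_⟩, fun z hz => ?_⟩
  · refine ((hΦj z hz 1).const_mul (-θi / kappa2 θ₀ θ₁ θt θi)⁻¹).congr fun s hs => ?_
    rw [hint2 z hz s (hI hs), inv_mul_cancel_left₀ hq]
  · have hYΦ : ∀ z ∈ U, Yt z = ∫ s in (0 : ℝ)..1, Φ z s := by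
      intro z hz
      have hproj : ∀ j : Fin 2, (∫ s in (0 : ℝ)..1, Φ z s) j = ∫ s in (0 : ℝ)..1, Φ z s j :=
        fun j => ((ContinuousLinearMap.proj (R := ℂ) (φ := fun _ : Fin 2 => ℂ)
          j).intervalIntegral_comp_comm (hΦi z hz)).symm
      rw [hYt z hz]
      ext j
      fin_cases j
      · change _ = (∫ s in (0 : ℝ)..1, Φ z s) 0
        rw [hproj 0, intervalIntegral.integral_congr_ae_restrict (hint1 z hz)]
        rfl
      · change _ = (∫ s in (0 : ℝ)..1, Φ z s) 1
        rw [hproj 1, intervalIntegral.integral_congr (g := fun s =>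
          -θi / kappa2 θ₀ θ₁ θt θi * integrand2 κ (γ z) (f z) (ℓ z) s) fun s hs => hint2 z hz s
          (by rwa [uIcc_of_le (zero_le_one' ℝ)] at hs), intervalIntegral.integral_const_mul]
        rfl
    have main := hasDerivAt_eulerTransform hSc hU hUt (A := A) (C := C)
      (B := fun z => mulVecCLM (coeffMatrix t (κ + θ₀) (κ + θ₁) (κ + θt) (-kappa2 θ₀ θ₁ θt θi)
        (lam + κ / mu) mu k z)) hCd (κ := κ) (fun z w hz hw v => by
        have := congrArg (fun M => M *ᵥ v) (hN z w hz hw)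
        simpa only [hA, hC, mulVecCLM_apply, Matrix.smul_mulVec, Matrix.sub_mulVec,
          Matrix.mulVec_mulVec] using this)
      hAd hγc hγp (fun z _ => hγ0 z) (fun z _ => hγ1 z) hγS hfc hf0 hode
      (fun z hz => (hf1 z hz).self_of_nhds) hℓ hexp
      (fun z hz => pochhammer_log_eq (hℓzc z hz) fun s hs => by rw [hexp z hz s hs, hγ]) hz
    have main' := main.congr_of_eventuallyEq
      (f₁ := Yt) (by filter_upwards [hU.mem_nhds hz] with z hz using hYΦ z hz)
    unfold SolvesAt
    rw [hYΦ z hz]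
    exact main'
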